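/- Let $0<\alpha<1$ be a real number and let $G$ be a finite abelian group. For every real $c<\min(\alpha,\log 2)$ there is a constant $K>0$, depending only on $\alpha$, $G$ and $c$, such that the following holds for every $n\ge 0$. Let $X$ be a random symmetric $n\times n$ matrix with entries $X_{ij}\in\mathbb{Z}$ such that the entries $X_{ij}$ with $i\le j$ are independent (they need not be identically distributed). Suppose that for every prime $p$ dividing $|G|$, every $t\in\mathbb{Z}/p\mathbb{Z}$ and all $i\le j$, $$\mathbb{P}(X_{ij}\equiv t \pmod p)\le 1-\alpha .$$ Then $$\bigl|\,\mathbb{E}\bigl(\#\mathrm{Sur}(\mathrm{cok}(X),G)\bigr)-|\wedge^2 G|\,\bigr|\le K e^{-cn},$$ where the expectation is finite. Here $\mathrm{cok}(X)=\mathbb{Z}^n/X\mathbb{Z}^n$ is the cokernel of $X$, $\mathrm{Sur}(A,B)$ is the set of surjective group homomorphisms from $A$ to $B$, and $\wedge^2 G$ is the exterior square of $G$, that is, the quotient of $G\otimes_{\mathbb{Z}} G$ by the subgroup generated by the elements $g\otimes g$, $g\in G$. -/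

import Mathlib

open MeasureTheory ProbabilityTheory

/-- The cokernel `Rⁿ / colspace(M)` of an `n × n` matrix `M` over `R`. -/
abbrev Matrix.Cok {R : Type*} [CommRing R] {n : ℕ} (M : Matrix (Fin n) (Fin n) R) : Type _ :=
  (Fin n → R) ⧸ LinearMap.range M.mulVecLin

/-- The set `Sur(A, B)` of surjective group homomorphisms from `A` to `B`. -/
abbrev Sur (A B : Type*) [AddCommGroup A] [AddCommGroup B] : Type _ :=
  {f : A →+ B // Function.Surjective f}

/-- A random symmetric integer `n × n` matrix on a probability space, whose entries on and above
the diagonal are independent. -/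
structure IsRandomSymmetric {Ω : Type*} [MeasurableSpace Ω] (μ : Measure Ω) {n : ℕ}
    (X : Ω → Matrix (Fin n) (Fin n) ℤ) : Prop where
  measurable_entry : ∀ i j, Measurable fun ω => X ω i j
  symm : ∀ ω, (X ω).IsSymm
  indep : iIndepFun
    (fun (e : {e : Fin n × Fin n // e.1 ≤ e.2}) (ω : Ω) => X ω e.1.1 e.1.2) μ

/-!
Homomorphisms from the cokernel of `X` to `G` are the homomorphisms `F : ℤ ^ n → G` with `F X = 0`.
Fourier inversion turns their expected number into `|G| ^ (-n)` times a sum over `n`-tuples `u` in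
`P = G × Ĝ` of the expected phase `E ∏ i, Q (u i) ^ X i i * ∏ i < j, b (u i) (u j) ^ X i j`, where
`Q (g, χ) = χ g` and `b` is its polarisation, a perfect symmetric pairing on `P`.

The sum concentrates on Lagrangian subgroups. If two values of `u` that are not orthogonal are both
taken a positive proportion of times, then of order `n ^ 2` coefficients are nontrivial and the
expected phase is negligible. Otherwise the frequent values span an isotropic subgroup `L`, and `u`
has few entries outside `L`. Isotropic subgroups have order `|G|` or at most `|G| / 2`; the smaller
ones contribute at most `2 ^ (-n)`, up to a factor `exp (ε * n)`. For `L` of order `|G|` the tuples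
near `L` are divided into cosets `D + L ^ n`. On such a coset the phase is a product of characters of
`L` depending on the columns of `X`, so that its sum over the coset is `|L| ^ n` times the phase of
`D` if all these characters are trivial, and zero otherwise
(`sum_matrixPhase_coset`). Each column gives a condition on an entry of its own, so all are trivial
with probability at most `(1 - α) ^ (n - 1)`, except on the trivial coset when `Q` is trivial
on `L`: then the sum is exactly `|G| ^ n`. Summing over cosets before taking absolute values is what
gives every rate below `min α (log 2)`; the needed inequality is `1 - α ≤ exp (-α)`. This is
`exists_lagrangian_estimate` combined with `norm_expectedPhase_le_exp` and
`norm_sum_expectedPhase_coset_sub_le`.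

So the expected number of homomorphisms to `G` is close to the number of Lagrangian subgroups of `P`
on which `Q` is trivial. Such a subgroup is the graph of an alternating pairing on its projection `H`
to `G`, and the alternating pairings on `H` are the characters of `∧² H`; hence the number is
`∑ H, |∧² H|` over the subgroups `H` of `G` (`card_singular_lagrangian`). Sorting homomorphisms by
their image and inducting on `|G|` isolates the term `|∧² G|` for surjections.
-/

/-! ### Isotropic subgroups for a pairing with values in characters -/

section Isotropic

variable {P : Type*} [AddCommGroup P]

/-- `L` is isotropic for the pairing `b` (written multiplicatively, with values in `ℂ`). In
particular `b x x = 1` for `x ∈ L`, but no quadratic refinement of `b` is required to vanish. -/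
def IsIsotropic (b : P →+ AddChar P ℂ) (L : AddSubgroup P) : Prop :=
  ∀ x ∈ L, ∀ y ∈ L, b x y = 1

lemma isIsotropic_closure {b : P →+ AddChar P ℂ} {s : Set P}
    (h : ∀ x ∈ s, ∀ y ∈ s, b x y = 1) : IsIsotropic b (AddSubgroup.closure s) := by
  intro x hx y hy
  induction hx, hy using AddSubgroup.closure_induction₂ with
  | mem x y hx hy => exact h x hx y hy
  | zero_left y hy => simp
  | zero_right x hx => simp
  | add_left x y z hx hy hz h1 h2 => simp [h1, h2]
  | add_right x y z hx hy hz h1 h2 => simp [AddChar.map_add_eq_mul, h1, h2]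
  | neg_left x y hx hy h => simp [h, AddChar.map_neg_eq_inv]
  | neg_right x y hx hy h => simp [AddChar.map_neg_eq_inv, h]

/-- Restriction of characters to a subgroup. -/
def restrictChar (L : AddSubgroup P) : AddChar P ℂ →+ AddChar L ℂ where
  toFun χ := χ.compAddMonoidHom L.subtype
  map_zero' := by ext; simp
  map_add' _ _ := by ext; simp

@[simp] lemma restrictChar_apply (L : AddSubgroup P) (χ : AddChar P ℂ) (x : L) :
    restrictChar L χ x = χ x := rfl

/-- Characters of a subgroup of a finite abelian group extend to the group. -/
lemma restrictChar_surjective [Finite P] (L : AddSubgroup P) :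
    Function.Surjective (restrictChar L) := by
  intro ψ
  let φ : AddSubgroup.toSubgroup L →* ℂ :=
    { toFun := fun x => ψ ⟨Multiplicative.toAdd x.1, x.2⟩
      map_one' := ψ.map_zero_eq_one
      map_mul' := fun x y => ψ.map_add_eq_mul ⟨_, x.2⟩ ⟨_, y.2⟩ }
  obtain ⟨χ, hχ⟩ := MonoidHom.domRestrict_surjective ℂ (AddSubgroup.toSubgroup L) φ.toHomUnits
  refine ⟨AddChar.toMonoidHomEquiv.symm ((Units.coeHom ℂ).comp χ), ?_⟩
  ext x
  have h := DFunLike.congr_fun hχ ⟨Multiplicative.ofAdd x.1, x.2⟩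
  exact congrArg Units.val h

/-- A subgroup and its orthogonal complement, here the kernel of `x ↦ b x` restricted to `L`, have
complementary orders. -/
lemma card_mul_card_orthogonal [Finite P] {b : P →+ AddChar P ℂ} (hb : Function.Injective b)
    (L : AddSubgroup P) :
    Nat.card L * Nat.card ((restrictChar L).comp b).ker = Nat.card P := by
  have := Fintype.ofFinite P
  have := Fintype.ofFinite L
  have hbij : Function.Bijective b := by
    rw [Fintype.bijective_iff_injective_and_card]
    exact ⟨hb, (AddChar.card_eq).symm⟩
  have hs : Function.Surjective ((restrictChar L).comp b) :=
    (restrictChar_surjective L).comp hbij.surjective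
  have h1 := AddSubgroup.card_eq_card_quotient_mul_card_addSubgroup ((restrictChar L).comp b).ker
  rw [h1, Nat.card_congr (QuotientAddGroup.quotientKerEquivOfSurjective _ hs).toEquiv,
    Nat.card_eq_fintype_card (α := AddChar L ℂ), AddChar.card_eq, Nat.card_eq_fintype_card (α := L)]

variable {b : P →+ AddChar P ℂ} {q : ℕ}

lemma IsIsotropic.le_ker {L : AddSubgroup P} (hL : IsIsotropic b L) :
    L ≤ ((restrictChar L).comp b).ker := by
  intro x hx
  rw [AddMonoidHom.mem_ker]
  ext y
  simpa using hL x hx y y.2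

variable [Finite P]

lemma two_mul_le_of_dvd_of_ne {a q : ℕ} (h : a ∣ q) (hq : 0 < q) (hne : a ≠ q) : 2 * a ≤ q := by
  obtain ⟨k, rfl⟩ := h
  have : k ≠ 1 := by rintro rfl; simp at hne
  have : k ≠ 0 := by rintro rfl; simp at hq
  rw [mul_comm]
  exact Nat.mul_le_mul_left a (by omega)

/-- In a group of order `q ^ 2`, an isotropic subgroup has order `q` or at most `q / 2`: since `L` is
contained in its orthogonal complement, `|L| ^ 2` divides `q ^ 2`. -/
lemma IsIsotropic.card_dichotomy (hb : Function.Injective b) (hP : Nat.card P = q ^ 2)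
    {L : AddSubgroup P} (hL : IsIsotropic b L) : Nat.card L = q ∨ 2 * Nat.card L ≤ q := by
  have h1 := card_mul_card_orthogonal hb L
  have h2 := AddSubgroup.card_dvd_of_le hL.le_ker
  have h3 : Nat.card L ^ 2 ∣ q ^ 2 := by
    rw [← hP, ← h1, sq]; exact Nat.mul_dvd_mul_left _ h2
  rw [Nat.pow_dvd_pow_iff two_ne_zero] at h3
  have hq : 0 < q := by
    rcases Nat.eq_zero_or_pos q with rfl | h
    · have := Nat.card_pos (α := P); simp_all
    · exact h
  by_cases h : Nat.card L = q
  · exact .inl h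
  · exact .inr (two_mul_le_of_dvd_of_ne h3 hq h)

/-- An isotropic subgroup of order `q` in a group of order `q ^ 2` is its own orthogonal
complement. -/
lemma IsIsotropic.mem_of_orthogonal (hb : Function.Injective b) (hP : Nat.card P = q ^ 2)
    {L : AddSubgroup P} (hL : IsIsotropic b L) (hc : Nat.card L = q) {d : P}
    (hd : ∀ l ∈ L, b d l = 1) : d ∈ L := by
  have h1 := card_mul_card_orthogonal hb L
  have hq : 0 < Nat.card L := Nat.card_pos
  rw [hP, ← hc, sq] at h1
  have h2 := Nat.eq_of_mul_eq_mul_left hq h1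
  have h3 := AddSubgroup.eq_of_le_of_card_ge hL.le_ker h2.le
  rw [h3, AddMonoidHom.mem_ker]
  ext l
  simpa using hd l l.2

end Isotropic

/-! ### Tuples with most entries in a subgroup -/

/-- A factor exponentially small in `n ^ 2` absorbs any exponential in `n`. -/
lemma exp_decay {A r η c : ℝ} (hr : 0 < r) (hη : 0 < η) :
    ∃ K : ℝ, ∀ n : ℕ, A ^ n * Real.exp (-r * ((η * n) ^ 2 - n)) ≤ K * Real.exp (-c * n) := by
  set B := r + c + |A| with hB
  refine ⟨Real.exp (B ^ 2 / (4 * (r * η ^ 2))), fun n => ?_⟩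
  have h1 : A ^ n ≤ Real.exp (|A| * n) := by
    rw [mul_comm, Real.exp_nat_mul]
    refine (le_abs_self _).trans ?_
    rw [abs_pow]
    gcongr
    linarith [Real.add_one_le_exp |A|]
  calc _ ≤ Real.exp (|A| * n) * Real.exp (-r * ((η * n) ^ 2 - n)) := by gcongr
    _ ≤ _ := by
      rw [← Real.exp_add, ← Real.exp_add, Real.exp_le_exp]
      have h0 : 0 < r * η ^ 2 := by positivity
      have : B * n - r * η ^ 2 * n ^ 2 ≤ B ^ 2 / (4 * (r * η ^ 2)) := by
        rw [le_div_iff₀ (by positivity)]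
        nlinarith [sq_nonneg (B - 2 * (r * η ^ 2) * n)]
      nlinarith [this]

section Counting
open scoped Classical
open Finset

variable {P : Type*} [AddCommGroup P] [Fintype P]

/-- The `n`-tuples with at most `θ * n` entries outside the subgroup `L`. -/
noncomputable def nearTuples (n : ℕ) (θ : ℝ) (L : AddSubgroup P) : Finset (Fin n → P) :=
  {u | ((#{i | u i ∉ L} : ℕ) : ℝ) ≤ θ * n}

lemma mem_nearTuples {n : ℕ} {θ : ℝ} {L : AddSubgroup P} {u : Fin n → P} :
    u ∈ nearTuples n θ L ↔ ((#{i | u i ∉ L} : ℕ) : ℝ) ≤ θ * n := by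
  simp [nearTuples]

/-- Weigh each tuple by `z` to the number of its entries outside `L`. -/
lemma card_nearTuples_le_of_weight {z : ℝ} (hz : 0 < z) (hz1 : z < 1) (n : ℕ) (θ : ℝ)
    (L : AddSubgroup P) :
    (#(nearTuples n θ L) : ℝ) * z ^ (θ * n) ≤ (Nat.card L * (1 + z * Nat.card P)) ^ n := by
  have h1 : (#(nearTuples n θ L) : ℝ) * z ^ (θ * n) ≤
      ∑ u : Fin n → P, ∏ i, (if u i ∉ L then z else 1) := by
    rw [← nsmul_eq_mul, ← sum_const]
    refine (sum_le_sum (g := fun u => ∏ i, (if u i ∉ L then z else 1)) fun u hu => ?_).trans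
      (sum_le_sum_of_subset_of_nonneg (subset_univ _) fun u _ _ =>
        prod_nonneg fun i _ => by split_ifs <;> positivity)
    rw [prod_ite, prod_const, prod_const_one, mul_one, ← Real.rpow_natCast]
    exact Real.rpow_le_rpow_of_exponent_ge hz hz1.le (mem_nearTuples.1 hu)
  refine h1.trans ?_
  have h2 : ∑ u : Fin n → P, ∏ i, (if u i ∉ L then z else 1) =
      (∑ x : P, if x ∉ L then z else 1) ^ n := by
    rw [Fintype.sum_pow]
  rw [h2]
  have h3 : (1 : ℝ) ≤ Nat.card L := by exact_mod_cast Nat.card_pos (α := L)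
  refine pow_le_pow_left₀ (sum_nonneg fun i _ => by split_ifs <;> positivity) ?_ n
  have h4 : (#{x : P | x ∈ L} : ℝ) = Nat.card L := by
    rw [Nat.card_eq_fintype_card, Fintype.card_subtype]
  have h5 : (#{x : P | x ∉ L} : ℝ) ≤ Nat.card P := by
    rw [Nat.card_eq_fintype_card]; exact_mod_cast card_le_univ _
  rw [sum_ite, sum_const, sum_const, nsmul_eq_mul, nsmul_eq_mul]
  simp only [not_not]
  rw [h4]
  have : 0 ≤ z * Nat.card P := by positivity
  nlinarith

/-- For small `θ` there are hardly more tuples near `L` than tuples in `L`, on the exponential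
scale. -/
lemma exists_card_nearTuples_le (P : Type*) [AddCommGroup P] [Fintype P] {ε : ℝ} (hε : 0 < ε) :
    ∃ θ : ℝ, 0 < θ ∧ ∀ (n : ℕ) (L : AddSubgroup P),
      (#(nearTuples n θ L) : ℝ) ≤ (Nat.card L * Real.exp ε) ^ n := by
  have hp : (0 : ℝ) < Nat.card P := by exact_mod_cast Nat.card_pos (α := P)
  -- `z` is chosen with `1 + z * |P| ≤ exp (ε / 2)`, and `θ` with `z ^ (-θ) = exp (ε / 2)`
  set z : ℝ := min (1 / 2) (ε / 2 / Nat.card P) with hz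
  have hz0 : 0 < z := by positivity
  have hz1 : z < 1 := (min_le_left _ _).trans_lt (by norm_num)
  have hzp : z * Nat.card P ≤ ε / 2 := by
    rw [← le_div_iff₀ hp]; exact min_le_right _ _
  have hlog : Real.log z < 0 := Real.log_neg hz0 hz1
  refine ⟨ε / 2 / (- Real.log z), by have := neg_pos.2 hlog; positivity, fun n L => ?_⟩
  have h := card_nearTuples_le_of_weight hz0 hz1 n (ε / 2 / (- Real.log z)) L
  have h1 : z ^ (ε / 2 / (- Real.log z) * n) = Real.exp (-(ε / 2) * n) := by
    rw [Real.rpow_def_of_pos hz0]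
    have := hlog.ne
    congr 1
    field_simp
  rw [h1] at h
  have h2 : (#(nearTuples n (ε / 2 / (- Real.log z)) L) : ℝ) ≤
      (Nat.card L * (1 + z * Nat.card P)) ^ n * Real.exp (ε / 2 * n) := by
    rw [neg_mul, Real.exp_neg, ← div_eq_mul_inv, div_le_iff₀ (Real.exp_pos _)] at h
    exact h
  refine h2.trans ?_
  have h3 : Real.exp ε = Real.exp (ε / 2) * Real.exp (ε / 2) := by
    rw [← Real.exp_add]; ring_nf
  rw [mul_comm (ε / 2), Real.exp_nat_mul, ← mul_pow, h3, ← mul_assoc]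
  gcongr
  linarith [Real.add_one_le_exp (ε / 2)]

lemma nearTuples_inter_subset {n : ℕ} {θ : ℝ} {L L' : AddSubgroup P} {u : Fin n → P}
    (h : u ∈ nearTuples n θ L) (h' : u ∈ nearTuples n θ L') :
    u ∈ nearTuples n (2 * θ) (L ⊓ L') := by
  rw [mem_nearTuples] at *
  have : (#{i | u i ∉ L ⊓ L'} : ℕ) ≤ #{i | u i ∉ L} + #{i | u i ∉ L'} := by
    refine (card_le_card fun i hi => ?_).trans (card_union_le _ _)
    simp only [mem_union, mem_filter, mem_univ, true_and, AddSubgroup.mem_inf] at *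
    tauto
  have : (#{i | u i ∉ L ⊓ L'} : ℝ) ≤ #{i | u i ∉ L} + #{i | u i ∉ L'} := by exact_mod_cast this
  linarith

lemma nearTuples_mono {n : ℕ} {θ θ' : ℝ} (h : θ ≤ θ') {L : AddSubgroup P} :
    nearTuples n θ L ⊆ nearTuples n θ' L := by
  intro u hu
  rw [mem_nearTuples] at *
  exact hu.trans (by gcongr)

/-- The subgroup generated by the values that `u` takes more than `η * n` times. -/
def popularSpan {n : ℕ} (η : ℝ) (u : Fin n → P) : AddSubgroup P :=
  AddSubgroup.closure {g | η * n < (#{i | u i = g} : ℕ)}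

lemma mem_nearTuples_popularSpan {n : ℕ} {η θ : ℝ} (hη0 : 0 ≤ η) (hη : Nat.card P * η ≤ θ)
    (u : Fin n → P) :
    u ∈ nearTuples n θ (popularSpan η u) := by
  rw [mem_nearTuples]
  have h1 : #{i | u i ∉ popularSpan η u} ≤
      ∑ g ∈ ({g | g ∉ popularSpan η u} : Finset P), #{i | u i = g} := by
    rw [← card_biUnion]
    · refine card_le_card fun i hi => ?_
      simpa using hi
    · intro g _ h _ hgh
      rw [Function.onFun, disjoint_left]
      intro i hi hi'
      simp only [mem_filter, mem_univ, true_and] at hi hi'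
      exact hgh (hi.symm.trans hi')
  have h2 : ∀ g ∈ ({g | g ∉ popularSpan η u} : Finset P), (#{i | u i = g} : ℝ) ≤ η * n := by
    intro g hg
    simp only [mem_filter, mem_univ, true_and] at hg
    by_contra! h
    exact hg (AddSubgroup.subset_closure h)
  have h3 : (#{i | u i ∉ popularSpan η u} : ℝ) ≤
      ∑ g ∈ ({g | g ∉ popularSpan η u} : Finset P), (#{i | u i = g} : ℝ) := by exact_mod_cast h1
  have h4 := h3.trans (sum_le_card_nsmul _ _ _ h2)
  rw [nsmul_eq_mul] at h4
  have h5 : (#{g | g ∉ popularSpan η u} : ℝ) ≤ Nat.card P := by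
    rw [Nat.card_eq_fintype_card]; exact_mod_cast card_le_univ _
  calc _ ≤ _ := h4
    _ ≤ Nat.card P * (η * n) := by gcongr
    _ ≤ _ := by rw [← mul_assoc]; gcongr

lemma sum_nearTuples_translate {n : ℕ} (θ : ℝ) (L : AddSubgroup P) (A : (Fin n → P) → ℂ)
    (v : Fin n → L) :
    ∑ D ∈ nearTuples n θ L, A (fun i => v i + D i) = ∑ D ∈ nearTuples n θ L, A D := by
  refine sum_equiv (Equiv.addLeft (fun i => (v i : P))) (fun D => ?_) fun D _ => rfl
  rw [mem_nearTuples, mem_nearTuples]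
  have : ∀ i, Equiv.addLeft (fun i => (v i : P)) D i ∉ L ↔ D i ∉ L := fun i => by
    simp [AddSubgroup.add_mem_cancel_left]
  simp only [this]

/-- A sum over the tuples near `L` is an average over `D` near `L` of sums over the cosets
`D + L ^ n`. Only the trivial coset contributes `q ^ n`; it arises from `q ^ n` choices of `D`. -/
lemma norm_sum_nearTuples_sub_le {n q : ℕ} (θ : ℝ) (hθ : 0 ≤ θ) {L : AddSubgroup P}
    (hL : Nat.card L = q)
    (A : (Fin n → P) → ℂ) (s : Prop) {δ : ℝ}
    (h : ∀ D : Fin n → P, ‖∑ v : Fin n → L, A (fun i => v i + D i) -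
      if (∀ i, D i ∈ L) ∧ s then (q : ℂ) ^ n else 0‖ ≤ q ^ n * δ) :
    ‖∑ u ∈ nearTuples n θ L, A u - if s then (q : ℂ) ^ n else 0‖ ≤ #(nearTuples n θ L) * δ := by
  have hq : (0 : ℝ) < q := by rw [← hL]; exact_mod_cast Nat.card_pos
  have hcard : Fintype.card (Fin n → L) = q ^ n := by
    rw [Fintype.card_fun, Fintype.card_fin, ← hL, Nat.card_eq_fintype_card]
  have h1 : ∑ D ∈ nearTuples n θ L, ∑ v : Fin n → L, A (fun i => v i + D i) =
      (q : ℂ) ^ n * ∑ u ∈ nearTuples n θ L, A u := by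
    rw [sum_comm]
    simp_rw [sum_nearTuples_translate θ L A]
    rw [sum_const, card_univ, hcard, nsmul_eq_mul]
    push_cast; rfl
  have h2 : ∑ D ∈ nearTuples n θ L, (if (∀ i, D i ∈ L) ∧ s then (q : ℂ) ^ n else 0) =
      (q : ℂ) ^ n * if s then (q : ℂ) ^ n else 0 := by
    by_cases hs : s
    · simp only [hs, and_true, if_true]
      rw [← sum_filter, sum_const, nsmul_eq_mul]
      congr 1
      have h3 : (nearTuples n θ L).filter (fun D => ∀ i, D i ∈ L) =
          univ.image (fun (v : Fin n → L) i => (v i : P)) := by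
        ext D
        simp only [mem_filter, mem_image, mem_univ, true_and]
        constructor
        · rintro ⟨_, h⟩
          exact ⟨fun i => ⟨D i, h i⟩, rfl⟩
        · rintro ⟨v, rfl⟩
          refine ⟨?_, fun i => (v i).2⟩
          rw [mem_nearTuples]
          simp only [SetLike.coe_mem, not_true_eq_false, filter_false, card_empty, Nat.cast_zero]
          positivity
      have h4 : Function.Injective (fun (v : Fin n → L) i => (v i : P)) := fun v w hvw =>
        funext fun i => Subtype.ext (congrFun hvw i)
      rw [h3, card_image_of_injective _ h4, card_univ, hcard]
      push_cast; rfl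
    · simp [hs]
  have h3 : ‖(q : ℂ) ^ n * (∑ u ∈ nearTuples n θ L, A u - if s then (q : ℂ) ^ n else 0)‖ ≤
      #(nearTuples n θ L) * (q ^ n * δ) := by
    rw [mul_sub, ← h1, ← h2, ← sum_sub_distrib]
    exact (norm_sum_le_of_le _ fun D _ => h D).trans (by rw [sum_const, nsmul_eq_mul])
  rw [norm_mul, norm_pow, Complex.norm_natCast] at h3
  have : (0 : ℝ) < q ^ n := by positivity
  refine le_of_mul_le_mul_left ?_ this
  linarith

/-! ### Concentration on Lagrangian subgroups -/

variable {b : P →+ AddChar P ℂ} {q : ℕ}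

/-- Up to an error, each tuple `u` with `A u` not negligible lies near exactly one isotropic subgroup
of order `q`. If it lies near none, then its popular values are not pairwise orthogonal, or they
span an isotropic subgroup of order at most `q / 2`; if it lies near two, then it lies near their
intersection. -/
lemma norm_sub_sum_lagrangian_le (hb : Function.Injective b) (hP : Nat.card P = q ^ 2) {n : ℕ}
    {θ η r : ℝ} (hθ : 0 ≤ θ) (hη0 : 0 ≤ η) (hη : Nat.card P * η ≤ θ) (hr : 0 ≤ r)
    {A : (Fin n → P) → ℂ} (hA : ∀ u, ‖A u‖ ≤ 1)
    (hbad : ∀ u g h, b g h ≠ 1 → ‖A u‖ ≤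
      Real.exp (-r * ((#{i | u i = g} : ℕ) * (#{i | u i = h} : ℕ) - n))) (u : Fin n → P) :
    ‖A u - ∑ L : AddSubgroup P with IsIsotropic b L ∧ Nat.card L = q,
        if u ∈ nearTuples n θ L then A u else 0‖ ≤
      Real.exp (-r * ((η * n) ^ 2 - n)) +
        ∑ L ∈ univ.filter (fun L : AddSubgroup P => 2 * Nat.card L ≤ q),
        if u ∈ nearTuples n (2 * θ) L then (Fintype.card (AddSubgroup P) : ℝ) else 0 := by
  set S : Finset (AddSubgroup P) := {L | (IsIsotropic b L ∧ Nat.card L = q) ∧ u ∈ nearTuples n θ L}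
    with hS
  have hq : 0 < q := by
    rcases Nat.eq_zero_or_pos q with rfl | h
    · have := Nat.card_pos (α := P); simp_all
    · exact h
  have hsum : ∑ L : AddSubgroup P with IsIsotropic b L ∧ Nat.card L = q,
      (if u ∈ nearTuples n θ L then A u else 0) = #S * A u := by
    rw [← sum_filter, filter_filter, sum_const, nsmul_eq_mul]
  have h0 : (0 : ℝ) ≤ Real.exp (-r * ((η * n) ^ 2 - n)) := by positivity
  have hterm : ∀ L : AddSubgroup P, (0 : ℝ) ≤
      if u ∈ nearTuples n (2 * θ) L then (Fintype.card (AddSubgroup P) : ℝ) else 0 := fun L => by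
    split_ifs <;> positivity
  have hcard1 : (1 : ℝ) ≤ Fintype.card (AddSubgroup P) := by
    exact_mod_cast Fintype.card_pos (α := AddSubgroup P)
  -- a single small subgroup near which `u` lies already pays for the error
  have hsmall : ∀ L : AddSubgroup P, 2 * Nat.card L ≤ q → u ∈ nearTuples n (2 * θ) L →
      (Fintype.card (AddSubgroup P) : ℝ) ≤
        ∑ L ∈ univ.filter (fun L : AddSubgroup P => 2 * Nat.card L ≤ q),
        if u ∈ nearTuples n (2 * θ) L then (Fintype.card (AddSubgroup P) : ℝ) else 0 := by
    intro L hL hu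
    have := single_le_sum (f := fun L : AddSubgroup P =>
      if u ∈ nearTuples n (2 * θ) L then (Fintype.card (AddSubgroup P) : ℝ) else 0)
      (s := {L : AddSubgroup P | 2 * Nat.card L ≤ q}) (fun L _ => hterm L)
      (a := L) (by simpa using hL)
    rwa [if_pos hu] at this
  have h1 : (0 : ℝ) ≤ ∑ L ∈ univ.filter (fun L : AddSubgroup P => 2 * Nat.card L ≤ q),
        if u ∈ nearTuples n (2 * θ) L then (Fintype.card (AddSubgroup P) : ℝ) else 0 :=
    sum_nonneg fun L _ => hterm L
  rw [hsum]
  rcases lt_trichotomy #S 1 with hlt | heq | hgt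
  · have hS0 : #S = 0 := by omega
    rw [hS0, Nat.cast_zero, zero_mul, sub_zero]
    by_cases hiso : IsIsotropic b (popularSpan η u)
    · have hmem := mem_nearTuples_popularSpan hη0 hη u
      rcases hiso.card_dichotomy hb hP with hc | hc
      · have : popularSpan η u ∈ S := mem_filter.2 ⟨mem_univ _, ⟨hiso, hc⟩, hmem⟩
        simp [card_eq_zero.1 hS0] at this
      · have := hsmall _ hc (nearTuples_mono (by linarith) hmem)
        linarith [hA u]
    · have : ¬ ∀ x ∈ {g | η * n < (#{i | u i = g} : ℕ)}, ∀ y ∈ {g | η * n < (#{i | u i = g} : ℕ)},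
          b x y = 1 := fun h => hiso (isIsotropic_closure h)
      push Not at this
      obtain ⟨g, hg, h, hh, hgh⟩ := this
      have h2 := hbad u g h hgh
      have h3 : (η * n) ^ 2 ≤ (#{i | u i = g} : ℕ) * (#{i | u i = h} : ℕ) := by
        rw [sq]
        simp only [Set.mem_ofPred_eq] at hg hh
        gcongr
      have h4 : Real.exp (-r * ((#{i | u i = g} : ℕ) * (#{i | u i = h} : ℕ) - n)) ≤
          Real.exp (-r * ((η * n) ^ 2 - n)) := by
        rw [Real.exp_le_exp]; nlinarith
      linarith
  · rw [heq, Nat.cast_one, one_mul, sub_self, norm_zero]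
    positivity
  · obtain ⟨L, hL, L', hL', hne⟩ := one_lt_card.1 hgt
    simp only [hS, mem_filter, mem_univ, true_and] at hL hL'
    have hlt : 2 * Nat.card (L ⊓ L' : AddSubgroup P) ≤ q := by
      rw [← hL.1.2]
      refine two_mul_le_of_dvd_of_ne (AddSubgroup.card_dvd_of_le inf_le_left) Nat.card_pos ?_
      intro hc
      have h2 := AddSubgroup.eq_of_le_of_card_ge (inf_le_left : L ⊓ L' ≤ L) hc.ge
      have h3 : L ≤ L' := inf_eq_left.1 h2
      exact hne (AddSubgroup.eq_of_le_of_card_ge h3 (by rw [hL.1.2, hL'.1.2]))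
    have h2 := hsmall _ hlt (nearTuples_inter_subset hL.2 hL'.2)
    have h3 : ‖A u - #S * A u‖ ≤ Fintype.card (AddSubgroup P) := by
      rw [← one_sub_mul, norm_mul]
      have h4 : ‖(1 - #S : ℂ)‖ ≤ Fintype.card (AddSubgroup P) := by
        have h5 : (1 - #S : ℂ) = -((#S - 1 : ℕ) : ℂ) := by
          push_cast [Nat.cast_sub hgt.le]; ring
        rw [h5, norm_neg, Complex.norm_natCast]
        exact_mod_cast (Nat.sub_le _ _).trans (card_le_univ _)
      nlinarith [norm_nonneg (A u), hA u, norm_nonneg (1 - #S : ℂ)]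
    linarith

/-- Let `A` be a function on `P ^ n`, `|P| = q ^ 2`, which is very small at tuples where two
non-orthogonal values are both frequent, and whose sums over the cosets of `L ^ n`, for `L` isotropic
of order `q`, are exponentially smaller than `q ^ n`, except for the trivial coset when `s L` holds,
where the sum is close to `q ^ n`. Then `∑ u, A u` is `q ^ n` times the number of `L` satisfying `s`,
up to a relative error `exp (-c * n)`. -/
theorem exists_lagrangian_estimate (hb : Function.Injective b) (hP : Nat.card P = q ^ 2)
    {r C a c : ℝ} (hr : 0 < r) (hc : c < min a (Real.log 2)) :
    ∃ K : ℝ, ∀ (n : ℕ) (A : (Fin n → P) → ℂ) (s : AddSubgroup P → Prop),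
      (∀ u, ‖A u‖ ≤ 1) →
      (∀ u g h, b g h ≠ 1 → ‖A u‖ ≤
        Real.exp (-r * ((#{i | u i = g} : ℕ) * (#{i | u i = h} : ℕ) - n))) →
      (∀ L : AddSubgroup P, IsIsotropic b L → Nat.card L = q → ∀ D : Fin n → P,
        ‖∑ v : Fin n → L, A (fun i => v i + D i) -
          if (∀ i, D i ∈ L) ∧ s L then (q : ℂ) ^ n else 0‖ ≤ q ^ n * (C * Real.exp (-a * n))) →
      ‖∑ u, A u - #{L : AddSubgroup P | (IsIsotropic b L ∧ Nat.card L = q) ∧ s L} * (q : ℂ) ^ n‖ ≤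
        q ^ n * (K * Real.exp (-c * n)) := by
  have hq : 0 < q := by
    rcases Nat.eq_zero_or_pos q with rfl | h
    · have := Nat.card_pos (α := P); simp_all
    · exact h
  have hq' : (0 : ℝ) < q := by exact_mod_cast hq
  -- `ε` is the room left for the number of exceptional positions; the threshold `θ` is half the one
  -- for `ε` because intersecting two subgroups doubles the number of exceptional positions
  set ε := min a (Real.log 2) - c with hε
  have hε0 : 0 < ε := by linarith
  obtain ⟨θ₀, hθ₀, hnear⟩ := exists_card_nearTuples_le P hε0
  set θ := θ₀ / 2 with hθ
  have hp : (0 : ℝ) < Nat.card P := by exact_mod_cast Nat.card_pos (α := P)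
  set η := θ / Nat.card P with hη
  have hη0 : 0 < η := by positivity
  obtain ⟨K₁, hK₁⟩ := exp_decay (A := Nat.card P) (c := c) hr hη0
  set σ : ℝ := (Fintype.card (AddSubgroup P) : ℝ) with hσ
  have hσ0 : 0 ≤ σ := by positivity
  refine ⟨K₁ + σ * σ + σ * |C|, fun n A s hA hbad hlag => ?_⟩
  have hnear' : ∀ L : AddSubgroup P, (#(nearTuples n θ L) : ℝ) ≤ (Nat.card L * Real.exp ε) ^ n :=
    fun L => le_trans (by exact_mod_cast card_le_card (nearTuples_mono (by linarith))) (hnear n L)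
  set T : Finset (AddSubgroup P) := {L | IsIsotropic b L ∧ Nat.card L = q} with hT
  have hqn : (1 : ℝ) ≤ (q : ℝ) ^ n := one_le_pow₀ (by exact_mod_cast hq)
  have hdec : ∀ t : ℝ, min a (Real.log 2) ≤ t →
      Real.exp ε ^ n * Real.exp (-t * n) ≤ Real.exp (-c * n) := by
    intro t ht
    rw [← Real.exp_nat_mul, ← Real.exp_add, Real.exp_le_exp]
    have : (0 : ℝ) ≤ n := by positivity
    nlinarith
  have step1 : ‖∑ u, A u - ∑ L ∈ T, ∑ u ∈ nearTuples n θ L, A u‖ ≤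
      q ^ n * ((K₁ + σ * σ) * Real.exp (-c * n)) := by
    have e1 : ∑ L ∈ T, ∑ u ∈ nearTuples n θ L, A u =
        ∑ u, ∑ L ∈ T, if u ∈ nearTuples n θ L then A u else 0 := by
      rw [sum_comm]
      refine sum_congr rfl fun L _ => ?_
      rw [← sum_filter]
      simp
    rw [e1, ← sum_sub_distrib]
    refine (norm_sum_le_of_le _ fun u _ => norm_sub_sum_lagrangian_le hb hP (θ := θ) (η := η)
      (r := r) (by positivity) hη0.le (by rw [hη]; field_simp; rfl) hr.le hA hbad u).trans ?_
    rw [sum_add_distrib, sum_const, nsmul_eq_mul, sum_comm, card_univ, Fintype.card_fun,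
      Fintype.card_fin, ← Nat.card_eq_fintype_card, Nat.cast_pow]
    have e2 : ∀ L ∈ ({L | 2 * Nat.card L ≤ q} : Finset (AddSubgroup P)),
        (∑ u : Fin n → P, if u ∈ nearTuples n (2 * θ) L then σ else 0) ≤
          q ^ n * (σ * Real.exp (-c * n)) := by
      intro L hL
      simp only [mem_filter, mem_univ, true_and] at hL
      rw [← sum_filter, sum_const, nsmul_eq_mul]
      have e3 : (#(nearTuples n (2 * θ) L) : ℝ) ≤ q ^ n * Real.exp (-c * n) := by
        calc _ ≤ (Nat.card L * Real.exp ε) ^ n := by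
              rw [hθ, mul_div_cancel₀ _ two_ne_zero]; exact hnear n L
          _ ≤ (q / 2 * Real.exp ε) ^ n := by
              gcongr
              rw [le_div_iff₀ two_pos]
              have : (2 * Nat.card L : ℝ) ≤ q := by exact_mod_cast hL
              linarith
          _ = q ^ n * (Real.exp ε ^ n * Real.exp (-Real.log 2 * n)) := by
              rw [mul_comm (-Real.log 2), Real.exp_nat_mul, Real.exp_neg, Real.exp_log two_pos,
                ← mul_pow, ← mul_pow]
              ring
          _ ≤ _ := by gcongr; exact hdec _ (min_le_right _ _)
      have e4 : (filter (fun u => u ∈ nearTuples n (2 * θ) L) univ) = nearTuples n (2 * θ) L := by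
        simp
      rw [e4]
      calc _ ≤ q ^ n * Real.exp (-c * n) * σ := by gcongr
        _ = _ := by ring
    have e5 := sum_le_sum e2
    rw [sum_const, nsmul_eq_mul] at e5
    have e6 : (#{L : AddSubgroup P | 2 * Nat.card L ≤ q} : ℝ) ≤ σ := Nat.cast_le.2 (card_le_univ _)
    have e7 := hK₁ n
    have e8 : (0 : ℝ) ≤ q ^ n * (σ * Real.exp (-c * n)) := by positivity
    have e9 : K₁ * Real.exp (-c * n) ≤ q ^ n * (K₁ * Real.exp (-c * n)) := by
      refine le_mul_of_one_le_left (le_trans ?_ e7) hqn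
      positivity
    nlinarith
  have step2 : ‖∑ L ∈ T, ∑ u ∈ nearTuples n θ L, A u -
      #{L : AddSubgroup P | (IsIsotropic b L ∧ Nat.card L = q) ∧ s L} * (q : ℂ) ^ n‖ ≤
      q ^ n * (σ * |C| * Real.exp (-c * n)) := by
    have e1 : #{L : AddSubgroup P | (IsIsotropic b L ∧ Nat.card L = q) ∧ s L} * (q : ℂ) ^ n =
        ∑ L ∈ T, if s L then (q : ℂ) ^ n else 0 := by
      rw [← sum_filter, sum_const, nsmul_eq_mul, hT, filter_filter]
    rw [e1, ← sum_sub_distrib]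
    have e2 : ∀ L ∈ T, ‖∑ u ∈ nearTuples n θ L, A u - if s L then (q : ℂ) ^ n else 0‖ ≤
        q ^ n * (|C| * Real.exp (-c * n)) := by
      intro L hL
      simp only [hT, mem_filter, mem_univ, true_and] at hL
      refine (norm_sum_nearTuples_sub_le θ (by positivity) hL.2 A (s L)
        (δ := |C| * Real.exp (-a * n)) fun D => (hlag L hL.1 hL.2 D).trans ?_).trans ?_
      · gcongr
        exact le_abs_self C
      calc _ ≤ (q * Real.exp ε) ^ n * (|C| * Real.exp (-a * n)) := by
            have := hnear' L
            rw [hL.2] at this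
            gcongr
        _ = q ^ n * (|C| * (Real.exp ε ^ n * Real.exp (-a * n))) := by rw [mul_pow]; ring
        _ ≤ _ := by gcongr; exact hdec _ (min_le_left _ _)
    refine (norm_sum_le_of_le _ e2).trans ?_
    rw [sum_const, nsmul_eq_mul]
    have e3 : (#T : ℝ) ≤ σ := Nat.cast_le.2 (card_le_univ _)
    calc _ ≤ σ * (q ^ n * (|C| * Real.exp (-c * n))) := by gcongr
      _ = _ := by ring
  calc _ = ‖(∑ u, A u - ∑ L ∈ T, ∑ u ∈ nearTuples n θ L, A u) +
        (∑ L ∈ T, ∑ u ∈ nearTuples n θ L, A u -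
      #{L : AddSubgroup P | (IsIsotropic b L ∧ Nat.card L = q) ∧ s L} * (q : ℂ) ^ n)‖ := by
        congr 1; ring
    _ ≤ _ := norm_add_le _ _
    _ ≤ _ := add_le_add step1 step2
    _ = _ := by ring

end Counting

/-! ### The quadratic form on a group times its dual -/

section Pairing

variable {G : Type*} [AddCommGroup G]

/-- The hyperbolic quadratic form `(g, χ) ↦ χ g` on `G × Ĝ`, with values written
multiplicatively. -/
def dualQuad (u : G × AddChar G ℂ) : ℂ := u.2 u.1

/-- The polarisation of `dualQuad`, as a homomorphism from `G × Ĝ` to its dual. -/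
def dualPairing (G : Type*) [AddCommGroup G] :
    (G × AddChar G ℂ) →+ AddChar (G × AddChar G ℂ) ℂ where
  toFun u :=
    { toFun := fun v => u.2 v.1 * v.2 u.1
      map_zero_eq_one' := by simp
      map_add_eq_mul' := fun v w => by
        simp only [Prod.fst_add, Prod.snd_add, AddChar.map_add_eq_mul, AddChar.add_apply]; ring }
  map_zero' := by ext; simp
  map_add' u v := by
    ext w
    simp only [Prod.fst_add, Prod.snd_add, AddChar.map_add_eq_mul, AddChar.add_apply,
      AddChar.coe_mk]
    ring

lemma dualPairing_apply (u v : G × AddChar G ℂ) :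
    dualPairing G u v = u.2 v.1 * v.2 u.1 := rfl

lemma dualPairing_comm (u v : G × AddChar G ℂ) : dualPairing G u v = dualPairing G v u := by
  rw [dualPairing_apply, dualPairing_apply, mul_comm]

lemma dualQuad_add (u v : G × AddChar G ℂ) :
    dualQuad (u + v) = dualQuad u * dualQuad v * dualPairing G u v := by
  simp only [dualQuad, dualPairing_apply, Prod.fst_add, Prod.snd_add, AddChar.map_add_eq_mul,
    AddChar.add_apply]
  ring

@[simp] lemma dualQuad_zero : dualQuad (0 : G × AddChar G ℂ) = 1 := by simp [dualQuad]

lemma dualPairing_injective [Finite G] : Function.Injective (dualPairing G) := by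
  rw [injective_iff_map_eq_zero]
  intro u hu
  have h : ∀ v : G × AddChar G ℂ, u.2 v.1 * v.2 u.1 = 1 := fun v => DFunLike.congr_fun hu v
  ext1
  · exact AddChar.forall_apply_eq_zero.1 fun ψ => by simpa using h (0, ψ)
  · ext g
    simpa using h (g, 0)

lemma card_prod_addChar [Finite G] : Nat.card (G × AddChar G ℂ) = Nat.card G ^ 2 := by
  have := Fintype.ofFinite G
  rw [Nat.card_prod, sq, Nat.card_eq_fintype_card (α := AddChar G ℂ), AddChar.card_eq,
    Nat.card_eq_fintype_card]

/-- The quadratic form restricted to an isotropic subgroup, which is a character, of order at most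
two. -/
def isotropicChar {L : AddSubgroup (G × AddChar G ℂ)} (hL : IsIsotropic (dualPairing G) L) :
    AddChar L ℂ where
  toFun x := dualQuad (x : G × AddChar G ℂ)
  map_zero_eq_one' := by simp
  map_add_eq_mul' x y := by
    rw [AddSubgroup.coe_add, dualQuad_add, hL x x.2 y y.2, mul_one]

lemma isotropicChar_apply {L : AddSubgroup (G × AddChar G ℂ)}
    (hL : IsIsotropic (dualPairing G) L) (x : L) :
    isotropicChar hL x = dualQuad (x : G × AddChar G ℂ) := rfl

end Pairing

/-! ### The phase attached to a symmetric matrix -/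

section UpperPairs
open scoped Classical
open Finset

/-- The positions on and above the diagonal of an `n × n` matrix. -/
abbrev UpperPair (n : ℕ) : Type := {e : Fin n × Fin n // e.1 ≤ e.2}

lemma prod_prod_eq_prod_upperPair {n : ℕ} (F : Fin n → Fin n → ℂ) :
    ∏ i, ∏ j, F i j = ∏ e : UpperPair n,
      if e.1.1 = e.1.2 then F e.1.1 e.1.1 else F e.1.1 e.1.2 * F e.1.2 e.1.1 := by
  have h1 : ∀ e : UpperPair n,
      (if e.1.1 = e.1.2 then F e.1.1 e.1.1 else F e.1.1 e.1.2 * F e.1.2 e.1.1) =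
      F e.1.1 e.1.2 * if e.1.1 ≠ e.1.2 then F e.1.2 e.1.1 else 1 := by
    intro e
    by_cases h : e.1.1 = e.1.2 <;> simp [h]
  simp_rw [h1]
  rw [← Fintype.prod_prod_type', ← prod_filter_mul_prod_filter_not univ (fun e => e.1 ≤ e.2),
    prod_mul_distrib]
  congr 1
  · exact prod_subtype _ (by simp) _
  · rw [← prod_subtype (s := univ.filter fun e : Fin n × Fin n => e.1 ≤ e.2) (by simp)
      (fun e => if e.1 ≠ e.2 then F e.2 e.1 else 1), ← prod_filter]
    refine prod_nbij' Prod.swap Prod.swap ?_ ?_ (by simp) (by simp) (by simp)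
    · intro e he
      simp only [mem_filter, mem_univ, true_and, not_le, Prod.fst_swap, Prod.snd_swap] at *
      exact ⟨he.le, he.ne⟩
    · intro e he
      simp only [mem_filter, mem_univ, true_and, not_le, Prod.fst_swap, Prod.snd_swap] at *
      exact lt_of_le_of_ne he.1 he.2

end UpperPairs

section PhaseSum
open scoped Classical
open Finset

variable {G : Type*} [AddCommGroup G] {n : ℕ}

/-- The character `C` evaluated at `F M`, where `u` lists the pairs `(F i, C i)`: here `F : ℤ ^ n → G`
is given by its values on the basis vectors and `C` is an `n`-tuple of characters of `G`. -/
noncomputable def matrixPhase (M : Matrix (Fin n) (Fin n) ℤ) (u : Fin n → G × AddChar G ℂ) : ℂ :=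
  ∏ j, (u j).2 (∑ i, M i j • (u i).1)

lemma AddChar.map_sum_eq_prod {A ι : Type*} [AddCommGroup A] (ψ : AddChar A ℂ) (s : Finset ι)
    (f : ι → A) : ψ (∑ i ∈ s, f i) = ∏ i ∈ s, ψ (f i) := by
  induction s using Finset.induction_on with
  | empty => simp
  | insert a s ha ih => rw [sum_insert ha, prod_insert ha, AddChar.map_add_eq_mul, ih]

lemma norm_matrixPhase [Finite G] (M : Matrix (Fin n) (Fin n) ℤ) (u : Fin n → G × AddChar G ℂ) :
    ‖matrixPhase M u‖ = 1 := by
  simp [matrixPhase, norm_prod, AddChar.norm_apply]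

/-- Fourier inversion: the phases detect the `F : ℤ ^ n → G` with `F M = 0`. -/
lemma sum_matrixPhase [Fintype G] (M : Matrix (Fin n) (Fin n) ℤ) :
    ∑ u : Fin n → G × AddChar G ℂ, matrixPhase M u =
      (Nat.card G : ℂ) ^ n * #{g : Fin n → G | ∀ j, ∑ i, M i j • g i = 0} := by
  have h1 : ∑ u : Fin n → G × AddChar G ℂ, matrixPhase M u =
      ∑ g : Fin n → G, ∑ χ : Fin n → AddChar G ℂ, ∏ j, χ j (∑ i, M i j • g i) := by
    rw [← Fintype.sum_prod_type']
    exact Fintype.sum_equiv (Equiv.arrowProdEquivProdArrow (Fin n) (fun _ => G) _) _ _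
      fun u => rfl
  rw [h1]
  have h2 : ∀ g : Fin n → G, ∑ χ : Fin n → AddChar G ℂ, ∏ j, χ j (∑ i, M i j • g i) =
      if ∀ j, ∑ i, M i j • g i = 0 then (Nat.card G : ℂ) ^ n else 0 := by
    intro g
    rw [← Fintype.piFinset_univ, ← prod_univ_sum (fun _ => univ)
      (fun j (χ : AddChar G ℂ) => χ (∑ i, M i j • g i))]
    simp_rw [AddChar.sum_apply_eq_ite]
    rw [Nat.card_eq_fintype_card]
    by_cases h : ∀ j, ∑ i, M i j • g i = 0
    · simp [h]
    · rw [if_neg h]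
      push Not at h
      obtain ⟨j, hj⟩ := h
      exact prod_eq_zero (mem_univ j) (if_neg hj)
  simp_rw [h2]
  rw [← sum_filter, sum_const, nsmul_eq_mul, mul_comm]

lemma matrixPhase_eq_prod_prod (M : Matrix (Fin n) (Fin n) ℤ) (u : Fin n → G × AddChar G ℂ) :
    matrixPhase M u = ∏ i, ∏ j, (u j).2 (u i).1 ^ M i j := by
  rw [prod_comm]
  simp_rw [matrixPhase, AddChar.map_sum_eq_prod, AddChar.map_zsmul_eq_zpow]

/-- The coefficient of the entry at `e` of a symmetric matrix in `matrixPhase`, in multiplicative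
notation. -/
noncomputable def phaseCoeff (u : Fin n → G × AddChar G ℂ) (e : UpperPair n) : ℂ :=
  if e.1.1 = e.1.2 then dualQuad (u e.1.1) else dualPairing G (u e.1.1) (u e.1.2)

lemma matrixPhase_eq_prod_coeff {M : Matrix (Fin n) (Fin n) ℤ} (hM : M.IsSymm)
    (u : Fin n → G × AddChar G ℂ) :
    matrixPhase M u = ∏ e : UpperPair n, phaseCoeff u e ^ M e.1.1 e.1.2 := by
  rw [matrixPhase_eq_prod_prod, prod_prod_eq_prod_upperPair]
  refine prod_congr rfl fun e _ => ?_
  by_cases h : e.1.1 = e.1.2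
  · simp [phaseCoeff, dualQuad, ← h]
  · rw [if_neg h, phaseCoeff, if_neg h, dualPairing_apply, hM.apply e.1.1 e.1.2, ← mul_zpow,
      mul_comm]

lemma matrixPhase_of_isotropic {M : Matrix (Fin n) (Fin n) ℤ} (hM : M.IsSymm)
    {L : AddSubgroup (G × AddChar G ℂ)} (hL : IsIsotropic (dualPairing G) L) (v : Fin n → L) :
    matrixPhase M (fun i => (v i : G × AddChar G ℂ)) = ∏ j, isotropicChar hL (v j) ^ M j j := by
  rw [matrixPhase_eq_prod_coeff hM]
  have h := prod_prod_eq_prod_upperPair (n := n)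
    (fun i j => if i = j then isotropicChar hL (v j) ^ M j j else 1)
  simp only [prod_ite_eq, mem_univ, if_true] at h
  rw [h]
  refine prod_congr rfl fun e _ => ?_
  by_cases h : e.1.1 = e.1.2
  · simp [phaseCoeff, ← h, isotropicChar_apply]
  · simp [phaseCoeff, h, Ne.symm h, hL _ (v e.1.1).2 _ (v e.1.2).2]

lemma matrixPhase_add {M : Matrix (Fin n) (Fin n) ℤ} (hM : M.IsSymm)
    (v D : Fin n → G × AddChar G ℂ) :
    matrixPhase M (fun i => v i + D i) = matrixPhase M D * (matrixPhase M v *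
      ∏ j, dualPairing G (∑ i, M i j • D i) (v j)) := by
  have h1 : ∀ j, dualPairing G (∑ i, M i j • D i) (v j) =
      (∏ i, (D i).2 (v j).1 ^ M i j) * ∏ i, (v j).2 (D i).1 ^ M i j := by
    intro j
    rw [dualPairing_comm, AddChar.map_sum_eq_prod, ← prod_mul_distrib]
    refine prod_congr rfl fun i _ => ?_
    rw [AddChar.map_zsmul_eq_zpow, dualPairing_apply, mul_zpow, mul_comm]
  simp_rw [h1, matrixPhase_eq_prod_prod]
  have h2 : ∏ j, ∏ i, (D i).2 (v j).1 ^ M i j = ∏ i, ∏ j, (D j).2 (v i).1 ^ M i j := by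
    refine prod_congr rfl fun i _ => prod_congr rfl fun j _ => ?_
    rw [hM.apply]
  have h3 : ∏ j, ∏ i, (v j).2 (D i).1 ^ M i j = ∏ i, ∏ j, (v j).2 (D i).1 ^ M i j := prod_comm
  rw [prod_mul_distrib, h2, h3]
  simp_rw [← prod_mul_distrib]
  refine prod_congr rfl fun i _ => prod_congr rfl fun j _ => ?_
  simp only [Prod.fst_add, Prod.snd_add, AddChar.map_add_eq_mul, AddChar.add_apply, mul_zpow]
  ring

/-- For `v ∈ L ^ n` the phase of `D + v` is the phase of `D` times `∏ j, columnChar M hL D j (v j)`;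
the `j`-th of these characters of `L` depends only on the `j`-th column of `M`. -/
def columnChar (M : Matrix (Fin n) (Fin n) ℤ) {L : AddSubgroup (G × AddChar G ℂ)}
    (hL : IsIsotropic (dualPairing G) L) (D : Fin n → G × AddChar G ℂ) (j : Fin n) :
    AddChar L ℂ :=
  restrictChar L (dualPairing G (∑ i, M i j • D i)) + M j j • isotropicChar hL

lemma sum_matrixPhase_coset [Fintype G] {M : Matrix (Fin n) (Fin n) ℤ} (hM : M.IsSymm)
    {L : AddSubgroup (G × AddChar G ℂ)} (hL : IsIsotropic (dualPairing G) L)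
    (D : Fin n → G × AddChar G ℂ) :
    ∑ v : Fin n → L, matrixPhase M (fun i => (v i : G × AddChar G ℂ) + D i) =
      matrixPhase M D * if ∀ j, columnChar M hL D j = 0 then (Nat.card L : ℂ) ^ n else 0 := by
  have h1 : ∀ v : Fin n → L, matrixPhase M (fun i => (v i : G × AddChar G ℂ) + D i) =
      matrixPhase M D * ∏ j, columnChar M hL D j (v j) := by
    intro v
    rw [matrixPhase_add hM, matrixPhase_of_isotropic hM hL, ← prod_mul_distrib]
    congr 1
    refine prod_congr rfl fun j _ => ?_
    rw [columnChar, AddChar.add_apply, restrictChar_apply, AddChar.zsmul_apply, mul_comm]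
  simp_rw [h1]
  rw [← mul_sum, ← Fintype.piFinset_univ, ← prod_univ_sum (fun _ => univ)
      (fun j x => columnChar M hL D j x)]
  congr 1
  simp_rw [AddChar.sum_eq_ite]
  rw [Nat.card_eq_fintype_card]
  by_cases h : ∀ j, columnChar M hL D j = 0
  · simp [h]
  · rw [if_neg h]
    push Not at h
    obtain ⟨j, hj⟩ := h
    exact prod_eq_zero (mem_univ j) (if_neg hj)

end PhaseSum

/-! ### Products of weights on a cyclic group -/

section FiniteProbability
open scoped Classical
open Finset

lemma sum_prod_eq_prod_sum {E S R : Type*} [Fintype E] [DecidableEq E] [Fintype S]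
    [CommSemiring R]
    (f : E → S → R) : ∑ x : E → S, ∏ e, f e (x e) = ∏ e, ∑ s, f e s := by
  rw [← Fintype.piFinset_univ, prod_univ_sum]

/-- Let `x` have independent coordinates. If for each `e ∈ J` the event forces `x e` into a set of
probability at most `ρ` that depends only on the coordinates outside `J`, then its probability is at
most `ρ ^ #J`. -/
lemma sum_section_le_of_finset {E S : Type*} [Fintype E] [Fintype S] [Nonempty S] {p : E → S → ℝ}
    (hp0 : ∀ e s, 0 ≤ p e s) (hp1 : ∀ e, ∑ s, p e s = 1) {ρ : ℝ} (J : Finset E)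
    (B : E → (E → S) → Set S)
    (hB : ∀ e ∈ J, ∀ x y : E → S, (∀ e' ∉ J, x e' = y e') → B e x = B e y)
    (hmass : ∀ e ∈ J, ∀ x, ∑ s with s ∈ B e x, p e s ≤ ρ) :
    ∑ x : E → S with ∀ e ∈ J, x e ∈ B e x, ∏ e, p e (x e) ≤ ρ ^ #J := by
  set T := Equiv.piEquivPiSubtypeProd (fun e => e ∈ J) (fun _ : E => S) with hT
  have hTin : ∀ y z (e : {e // e ∈ J}), T.symm (y, z) e = y e := fun y z e => by
    simp [hT, Equiv.piEquivPiSubtypeProd, e.2]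
  have hTout : ∀ y z (e : {e // e ∉ J}), T.symm (y, z) e = z e := fun y z e => by
    simp [hT, Equiv.piEquivPiSubtypeProd, e.2]
  rw [sum_filter, ← T.symm.sum_comp, Fintype.sum_prod_type, sum_comm]
  let y₀ : {e // e ∈ J} → S := fun _ => Classical.arbitrary S
  have h1 : ∀ z y, (if ∀ e ∈ J, T.symm (y, z) e ∈ B e (T.symm (y, z))
      then ∏ e, p e (T.symm (y, z) e) else 0) =
      (∏ e : {e // e ∉ J}, p e (z e)) * ∏ e : {e // e ∈ J},
        if y e ∈ B e (T.symm (y₀, z)) then p e (y e) else 0 := by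
    intro z y
    have h2 : ∀ e ∈ J, B e (T.symm (y, z)) = B e (T.symm (y₀, z)) := fun e he =>
      hB e he _ _ fun e' he' => (hTout y z ⟨e', he'⟩).trans (hTout y₀ z ⟨e', he'⟩).symm
    have h3 : ∏ e, p e (T.symm (y, z) e) =
        (∏ e : {e // e ∉ J}, p e (z e)) * ∏ e : {e // e ∈ J}, p e (y e) := by
      rw [← Fintype.prod_subtype_mul_prod_subtype (fun e => e ∈ J), mul_comm]
      simp_rw [hTin, hTout]
      congr!
    by_cases h : ∀ e ∈ J, T.symm (y, z) e ∈ B e (T.symm (y, z))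
    · rw [if_pos h, h3]
      congr 1
      refine prod_congr rfl fun e _ => ?_
      rw [if_pos]
      rw [← h2 e e.2, ← hTin y z e]
      exact h e e.2
    · rw [if_neg h]
      push Not at h
      obtain ⟨e, he, hne⟩ := h
      rw [prod_eq_zero (mem_univ (⟨e, he⟩ : {e // e ∈ J})), mul_zero]
      rw [if_neg]
      rw [← h2 e he, ← hTin y z ⟨e, he⟩]
      exact hne
  simp_rw [h1, ← mul_sum]
  have h4 : ∀ z : {e // e ∉ J} → S, ∑ y : {e // e ∈ J} → S, ∏ e : {e // e ∈ J},
      (if y e ∈ B e (T.symm (y₀, z)) then p e (y e) else 0) ≤ ρ ^ #J := by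
    intro z
    rw [sum_prod_eq_prod_sum (fun (e : {e // e ∈ J}) s =>
      if s ∈ B e (T.symm (y₀, z)) then p e s else 0)]
    have : ρ ^ #J = ∏ _e : {e // e ∈ J}, ρ := by simp
    rw [this]
    refine prod_le_prod (fun e _ => sum_nonneg fun s _ => by split_ifs <;> simp [hp0]) fun e _ => ?_
    rw [← sum_filter]
    exact hmass e e.2 _
  calc _ ≤ ∑ z : {e // e ∉ J} → S, (∏ e : {e // e ∉ J}, p e (z e)) * ρ ^ #J :=
        sum_le_sum fun z _ => mul_le_mul_of_nonneg_left (h4 z) (prod_nonneg fun e _ => hp0 _ _)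
    _ = _ := by
      rw [← sum_mul, sum_prod_eq_prod_sum (fun (e : {e // e ∉ J}) s => p e s)]
      simp [hp1]

/-- The previous lemma with the special coordinates listed by an injective family `c`. -/
lemma sum_section_le {E S ι : Type*} [Fintype E] [Fintype S] [Nonempty S] [Fintype ι]
    {p : E → S → ℝ}
    (hp0 : ∀ e s, 0 ≤ p e s) (hp1 : ∀ e, ∑ s, p e s = 1) {ρ : ℝ} {c : ι → E}
    (hc : Function.Injective c) (B : ι → (E → S) → Set S)
    (hB : ∀ i, ∀ x y : E → S, (∀ e' ∉ Set.range c, x e' = y e') → B i x = B i y)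
    (hmass : ∀ i, ∀ x, ∑ s with s ∈ B i x, p (c i) s ≤ ρ) :
    ∑ x : E → S with ∀ i, x (c i) ∈ B i x, ∏ e, p e (x e) ≤ ρ ^ Fintype.card ι := by
  have h := sum_section_le_of_finset hp0 hp1 (ρ := ρ) (univ.image c)
    (fun e x => {s | ∀ i, c i = e → s ∈ B i x}) ?_ ?_
  · rw [card_image_of_injective _ hc, card_univ] at h
    convert h using 2
    ext x
    simp only [mem_filter, mem_univ, true_and, mem_image, Set.mem_ofPred_eq]
    constructor
    · rintro h e _ i rfl
      exact h i
    · intro h i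
      exact h _ ⟨i, rfl⟩ i rfl
  · intro e _ x y hxy
    have : ∀ i, B i x = B i y := fun i => hB i x y fun e' he' => hxy e' (by simpa using he')
    simp only [this]
  · intro e he x
    obtain ⟨i, _, rfl⟩ := mem_image.1 he
    convert hmass i x using 2
    ext s
    simp only [mem_filter, mem_univ, true_and, Set.mem_ofPred_eq]
    exact ⟨fun h => h i rfl, fun h i' hi' => hc hi' ▸ h⟩

/-- A probability vector on `ℤ/N` giving mass at most `1 - α` to every residue class modulo every
prime divisor of `N`. -/
structure IsBalancedWeight {N : ℕ} [NeZero N] (α : ℝ) (p : ZMod N → ℝ) : Prop where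
  nonneg : ∀ s, 0 ≤ p s
  sum_eq_one : ∑ s, p s = 1
  balanced : ∀ ℓ : ℕ, ℓ.Prime → ℓ ∣ N → ∀ t : ZMod ℓ, ∑ s with (s.val : ZMod ℓ) = t, p s ≤ 1 - α

variable {N : ℕ} [NeZero N] {α : ℝ} {p : ZMod N → ℝ}

/-- The solutions `s` of `ζ ^ s * c = 1` lie in one residue class modulo any prime factor of the
order of `ζ`. -/
lemma IsBalancedWeight.sum_pow_mul_eq_one_le (hp : IsBalancedWeight α p) (hα : α ≤ 1) {ζ : ℂ}
    (hζ : ζ ^ N = 1) (hζ1 : ζ ≠ 1) (c : ℂ) : ∑ s with ζ ^ s.val * c = 1, p s ≤ 1 - α := by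
  by_cases h : ∃ s₀ : ZMod N, ζ ^ s₀.val * c = 1
  · obtain ⟨s₀, hs₀⟩ := h
    have hord : orderOf ζ ≠ 1 := by rwa [Ne, orderOf_eq_one_iff]
    obtain ⟨ℓ, hℓ, hdvd⟩ := Nat.exists_prime_and_dvd hord
    refine le_trans (sum_le_sum_of_subset_of_nonneg (fun s hs => ?_) fun s _ _ => hp.nonneg s)
      (hp.balanced ℓ hℓ (hdvd.trans (orderOf_dvd_of_pow_eq_one hζ)) (s₀.val : ZMod ℓ))
    simp only [mem_filter, mem_univ, true_and] at hs ⊢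
    have hc : c ≠ 0 := by rintro rfl; simp at hs
    have h1 : ζ ^ s.val = ζ ^ s₀.val := mul_right_cancel₀ hc (hs.trans hs₀.symm)
    have hf : IsOfFinOrder ζ := isOfFinOrder_iff_pow_eq_one.2 ⟨N, NeZero.pos N, hζ⟩
    rw [ZMod.natCast_eq_natCast_iff]
    exact (hf.pow_eq_pow_iff_modEq.1 h1).of_dvd hdvd
  · push Not at h
    rw [filter_false_of_mem fun s _ => h s, sum_empty]
    linarith

lemma exists_le_one_sub_re (N : ℕ) [NeZero N] :
    ∃ κ : ℝ, 0 < κ ∧ ∀ ζ : ℂ, ζ ^ N = 1 → ζ ≠ 1 → κ ≤ 1 - ζ.re := by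
  have hfin : {ζ : ℂ | ζ ^ N = 1 ∧ ζ ≠ 1}.Finite := by
    refine (Polynomial.nthRootsFinset N (1 : ℂ)).finite_toSet.subset fun ζ hζ => ?_
    simpa [Polynomial.mem_nthRootsFinset (NeZero.pos N)] using hζ.1
  have hpos : ∀ ζ ∈ {ζ : ℂ | ζ ^ N = 1 ∧ ζ ≠ 1}, 0 < 1 - ζ.re := by
    rintro ζ ⟨h1, h2⟩
    have hn : ‖ζ‖ = 1 := Complex.norm_eq_one_of_pow_eq_one h1 (NeZero.ne N)
    have hle := Complex.re_le_norm ζ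
    rw [hn] at hle
    refine sub_pos.2 (lt_of_le_of_ne hle fun hre => h2 ?_)
    have h3 := Complex.sq_norm ζ
    rw [hn, Complex.normSq_apply, hre] at h3
    apply Complex.ext
    · simpa using hre
    · simpa using (by nlinarith : ζ.im * ζ.im = 0)
  rcases Set.eq_empty_or_nonempty {ζ : ℂ | ζ ^ N = 1 ∧ ζ ≠ 1} with he | hne
  · refine ⟨1, one_pos, fun ζ h1 h2 => ?_⟩
    have : ζ ∈ {ζ : ℂ | ζ ^ N = 1 ∧ ζ ≠ 1} := ⟨h1, h2⟩
    simp [he] at this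
  · obtain ⟨ζ₀, h0, hmin⟩ := Set.exists_min_image _ (fun ζ : ℂ => 1 - ζ.re) hfin hne
    exact ⟨_, hpos _ h0, fun ζ h1 h2 => hmin ζ ⟨h1, h2⟩⟩

/-- The squared absolute value of the expectation of `ζ ^ s` is the expectation of the real part of
`ζ ^ (s - t)`, with `s` and `t` independent, and `ζ ^ (s - t) = 1` has probability at most
`1 - α`. -/
lemma IsBalancedWeight.norm_sum_mul_pow_le (hp : IsBalancedWeight α p) (hα : α ≤ 1) {κ : ℝ}
    (hκ0 : 0 ≤ κ) (hκ : ∀ ζ : ℂ, ζ ^ N = 1 → ζ ≠ 1 → κ ≤ 1 - ζ.re) {ζ : ℂ} (hζ : ζ ^ N = 1)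
    (hζ1 : ζ ≠ 1) : ‖∑ s, (p s : ℂ) * ζ ^ s.val‖ ≤ Real.exp (-(α * κ / 2)) := by
  have hn : ‖ζ‖ = 1 := Complex.norm_eq_one_of_pow_eq_one hζ (NeZero.ne N)
  have hinv : (starRingEnd ℂ) ζ = ζ⁻¹ := (Complex.inv_eq_conj hn).symm
  have hζ0 : ζ ≠ 0 := by rintro rfl; simp at hn
  have hsq : ‖∑ s, (p s : ℂ) * ζ ^ s.val‖ ^ 2 =
      ∑ t, p t * ∑ s, p s * (ζ ^ s.val * (ζ ^ t.val)⁻¹).re := by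
    have h1 : ((‖∑ s, (p s : ℂ) * ζ ^ s.val‖ ^ 2 : ℝ) : ℂ) =
        ∑ t, (p t : ℂ) * ∑ s, (p s : ℂ) * (ζ ^ s.val * (ζ ^ t.val)⁻¹) := by
      push_cast
      rw [← Complex.mul_conj', map_sum, sum_mul_sum, sum_comm]
      refine sum_congr rfl fun t _ => ?_
      rw [mul_sum]
      refine sum_congr rfl fun s _ => ?_
      rw [map_mul, Complex.conj_ofReal, map_pow, hinv, inv_pow]
      ring
    have h2 := congrArg Complex.re h1
    rw [Complex.ofReal_re, Complex.re_sum] at h2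
    rw [h2]
    refine sum_congr rfl fun t _ => ?_
    rw [Complex.re_ofReal_mul, Complex.re_sum]
    simp_rw [Complex.re_ofReal_mul]
  have hinner : ∀ t : ZMod N, ∑ s, p s * (ζ ^ s.val * (ζ ^ t.val)⁻¹).re ≤ 1 - α * κ := by
    intro t
    have h1 : ∀ s, p s * (ζ ^ s.val * (ζ ^ t.val)⁻¹).re ≤
        p s * (1 - κ) + κ * if ζ ^ s.val * (ζ ^ t.val)⁻¹ = 1 then p s else 0 := by
      intro s
      by_cases h : ζ ^ s.val * (ζ ^ t.val)⁻¹ = 1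
      · rw [if_pos h, h, Complex.one_re]; linarith
      · rw [if_neg h]
        have := hκ (ζ ^ s.val * (ζ ^ t.val)⁻¹) (by
          rw [mul_pow, inv_pow, pow_right_comm, hζ, pow_right_comm, hζ]; simp) h
        nlinarith [hp.nonneg s]
    refine (sum_le_sum fun s _ => h1 s).trans ?_
    rw [sum_add_distrib, ← sum_mul, ← mul_sum, hp.sum_eq_one, ← sum_filter]
    have := hp.sum_pow_mul_eq_one_le hα hζ hζ1 (ζ ^ t.val)⁻¹
    nlinarith
  have hle : ‖∑ s, (p s : ℂ) * ζ ^ s.val‖ ^ 2 ≤ 1 - α * κ := by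
    rw [hsq]
    refine (sum_le_sum fun t _ => mul_le_mul_of_nonneg_left (hinner t) (hp.nonneg t)).trans ?_
    rw [← sum_mul, hp.sum_eq_one, one_mul]
  refine (pow_le_pow_iff_left₀ (norm_nonneg _) (Real.exp_pos _).le two_ne_zero).1 ?_
  rw [← Real.exp_nat_mul]
  refine hle.trans ((Real.one_sub_le_exp_neg _).trans (le_of_eq ?_))
  congr 1
  push_cast; ring

end FiniteProbability

/-! ### The expected phase -/

section WeightedMoment
open scoped Classical
open Finset

/-- The position on or above the diagonal representing `(i, j)`. -/
def UpperPair.mk' {n : ℕ} (i j : Fin n) : UpperPair n := ⟨(min i j, max i j), min_le_max⟩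

lemma UpperPair.mk'_comm {n : ℕ} (i j : Fin n) : UpperPair.mk' i j = UpperPair.mk' j i := by
  simp [UpperPair.mk', min_comm, max_comm]

lemma UpperPair.mk'_eq_iff {n : ℕ} {i j k l : Fin n} :
    UpperPair.mk' i j = UpperPair.mk' k l ↔ i = k ∧ j = l ∨ i = l ∧ j = k := by
  simp only [UpperPair.mk', Subtype.mk.injEq, Prod.mk.injEq]
  grind

@[simp] lemma UpperPair.mk'_self {n : ℕ} (e : UpperPair n) : UpperPair.mk' e.1.1 e.1.2 = e := by
  ext1
  simp [UpperPair.mk', e.2]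

variable {n N : ℕ}

/-- The symmetric integer matrix whose entries on and above the diagonal are the representatives in
`[0, N)` of `x`. -/
def liftSymm (x : UpperPair n → ZMod N) : Matrix (Fin n) (Fin n) ℤ :=
  fun i j => ((x (UpperPair.mk' i j)).val : ℤ)

lemma liftSymm_isSymm (x : UpperPair n → ZMod N) : (liftSymm x).IsSymm := by
  ext i j
  simp [liftSymm, UpperPair.mk'_comm i j]

variable {G : Type*} [AddCommGroup G]

lemma AddChar.apply_pow_card (hG : Nat.card G = N) (χ : AddChar G ℂ) (g : G) : χ g ^ N = 1 := by
  rw [← AddChar.map_nsmul_eq_pow, ← hG, card_nsmul_eq_zero', AddChar.map_zero_eq_one]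

lemma columnChar_of_mem (M : Matrix (Fin n) (Fin n) ℤ) {L : AddSubgroup (G × AddChar G ℂ)}
    (hL : IsIsotropic (dualPairing G) L) {D : Fin n → G × AddChar G ℂ} (hD : ∀ i, D i ∈ L)
    (j : Fin n) : columnChar M hL D j = M j j • isotropicChar hL := by
  have h : restrictChar L (dualPairing G (∑ i, M i j • D i)) = 0 := by
    ext l
    exact hL _ (sum_mem fun i _ => zsmul_mem (hD i) _) l l.2
  rw [columnChar, h, zero_add]

lemma dualQuad_pow_card (hG : Nat.card G = N) (u : G × AddChar G ℂ) : dualQuad u ^ N = 1 :=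
  AddChar.apply_pow_card hG _ _

lemma dualPairing_pow_card (hG : Nat.card G = N) (u v : G × AddChar G ℂ) :
    dualPairing G u v ^ N = 1 := by
  rw [dualPairing_apply, mul_pow, AddChar.apply_pow_card hG, AddChar.apply_pow_card hG, one_mul]

lemma phaseCoeff_pow_card (hG : Nat.card G = N) (u : Fin n → G × AddChar G ℂ) (e : UpperPair n) :
    phaseCoeff u e ^ N = 1 := by
  rw [phaseCoeff]
  split_ifs
  · exact dualQuad_pow_card hG _
  · exact dualPairing_pow_card hG _ _

/-- Each pair of positions `i ≠ j` carrying non-orthogonal values `g`, `h` gives a nontrivial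
coefficient. -/
lemma card_mul_card_le_of_pairing_ne_one (u : Fin n → G × AddChar G ℂ) {g h : G × AddChar G ℂ}
    (hgh : dualPairing G g h ≠ 1) :
    #{i | u i = g} * #{i | u i = h} ≤ n + 2 * #{e | phaseCoeff u e ≠ 1} := by
  rw [← card_product]
  have h1 : ({i | u i = g} : Finset (Fin n)) ×ˢ ({i | u i = h} : Finset (Fin n)) ⊆
      univ.image (fun i => (i, i)) ∪
        (({e | phaseCoeff u e ≠ 1} : Finset (UpperPair n)).image (fun e => e.1) ∪
         ({e | phaseCoeff u e ≠ 1} : Finset (UpperPair n)).image (fun e => e.1.swap)) := by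
    rintro ⟨i, j⟩ hij
    simp only [mem_product, mem_filter, mem_univ, true_and] at hij
    rw [mem_union, mem_union]
    rcases lt_trichotomy i j with hlt | heq | hlt
    · refine .inr (.inl (mem_image.2 ⟨⟨(i, j), hlt.le⟩, ?_, rfl⟩))
      rw [mem_filter, phaseCoeff, if_neg hlt.ne, hij.1, hij.2]
      exact ⟨mem_univ _, hgh⟩
    · exact .inl (by simp [heq])
    · refine .inr (.inr (mem_image.2 ⟨⟨(j, i), hlt.le⟩, ?_, rfl⟩))
      rw [dualPairing_comm] at hgh
      rw [mem_filter, phaseCoeff, if_neg hlt.ne, hij.1, hij.2]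
      exact ⟨mem_univ _, hgh⟩
  refine (card_le_card h1).trans ((card_union_le _ _).trans ?_)
  have h2 : #(univ.image (fun i : Fin n => (i, i))) ≤ n := card_image_le.trans (by simp)
  have h3 := card_union_le (({e | phaseCoeff u e ≠ 1} : Finset (UpperPair n)).image (fun e => e.1))
    (({e | phaseCoeff u e ≠ 1} : Finset (UpperPair n)).image (fun e => e.1.swap))
  have h4 : #(({e | phaseCoeff u e ≠ 1} : Finset (UpperPair n)).image (fun e => e.1)) ≤ _ :=
    card_image_le
  have h5 : #(({e | phaseCoeff u e ≠ 1} : Finset (UpperPair n)).image (fun e => e.1.swap)) ≤ _ :=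
    card_image_le
  omega

variable [Fintype G] [NeZero N] {α : ℝ}
  {p : UpperPair n → ZMod N → ℝ}

/-- The expectation of `matrixPhase` for a symmetric matrix with independent entries distributed
according to `p`. -/
noncomputable def expectedPhase (p : UpperPair n → ZMod N → ℝ) (u : Fin n → G × AddChar G ℂ) : ℂ :=
  ∑ x : UpperPair n → ZMod N, ((∏ e, p e (x e) : ℝ) : ℂ) * matrixPhase (liftSymm x) u

lemma sum_prod_weight (hp : ∀ e, IsBalancedWeight α (p e)) :
    ∑ x : UpperPair n → ZMod N, ∏ e, p e (x e) = 1 := by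
  rw [sum_prod_eq_prod_sum]
  simp [fun e => (hp e).sum_eq_one]

lemma norm_expectedPhase_le_one (hp : ∀ e, IsBalancedWeight α (p e))
    (u : Fin n → G × AddChar G ℂ) : ‖expectedPhase p u‖ ≤ 1 := by
  refine (norm_sum_le _ _).trans (le_of_eq ?_)
  rw [← sum_prod_weight hp]
  refine sum_congr rfl fun x _ => ?_
  rw [norm_mul, norm_matrixPhase, mul_one, Complex.norm_real, Real.norm_of_nonneg]
  exact prod_nonneg fun e _ => (hp e).nonneg _

omit [Fintype G] in
lemma expectedPhase_eq_prod (p : UpperPair n → ZMod N → ℝ) (u : Fin n → G × AddChar G ℂ) :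
    expectedPhase p u = ∏ e, ∑ s, (p e s : ℂ) * phaseCoeff u e ^ s.val := by
  rw [← sum_prod_eq_prod_sum, expectedPhase]
  refine sum_congr rfl fun x _ => ?_
  rw [matrixPhase_eq_prod_coeff (liftSymm_isSymm x), Complex.ofReal_prod, ← prod_mul_distrib]
  refine prod_congr rfl fun e _ => ?_
  simp [liftSymm, -ZMod.natCast_val]

omit [Fintype G] in
lemma norm_expectedPhase_le (hp : ∀ e, IsBalancedWeight α (p e)) (hα : α ≤ 1)
    (hG : Nat.card G = N) {κ : ℝ} (hκ0 : 0 ≤ κ)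
    (hκ : ∀ ζ : ℂ, ζ ^ N = 1 → ζ ≠ 1 → κ ≤ 1 - ζ.re) (u : Fin n → G × AddChar G ℂ) :
    ‖expectedPhase p u‖ ≤ Real.exp (-(α * κ / 2)) ^ #{e | phaseCoeff u e ≠ 1} := by
  rw [expectedPhase_eq_prod, norm_prod, ← prod_const, prod_filter]
  refine prod_le_prod (fun _ _ => norm_nonneg _) fun e _ => ?_
  split_ifs with h
  · exact (hp e).norm_sum_mul_pow_le hα hκ0 hκ (phaseCoeff_pow_card hG u e) h
  · rw [not_not] at h
    refine (norm_sum_le _ _).trans (le_of_eq ?_)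
    rw [← (hp e).sum_eq_one]
    refine sum_congr rfl fun s _ => ?_
    rw [h, one_pow, mul_one, Complex.norm_real, Real.norm_of_nonneg ((hp e).nonneg s)]

omit [Fintype G] in
lemma norm_expectedPhase_le_exp (hp : ∀ e, IsBalancedWeight α (p e)) (hα0 : 0 ≤ α) (hα : α ≤ 1)
    (hG : Nat.card G = N) {κ : ℝ} (hκ0 : 0 ≤ κ)
    (hκ : ∀ ζ : ℂ, ζ ^ N = 1 → ζ ≠ 1 → κ ≤ 1 - ζ.re) (u : Fin n → G × AddChar G ℂ)
    (g h : G × AddChar G ℂ) (hgh : dualPairing G g h ≠ 1) :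
    ‖expectedPhase p u‖ ≤
      Real.exp (-(α * κ / 4) * ((#{i | u i = g} : ℕ) * (#{i | u i = h} : ℕ) - n)) := by
  refine (norm_expectedPhase_le hp hα hG hκ0 hκ u).trans ?_
  rw [← Real.exp_nat_mul, Real.exp_le_exp]
  have h1 : (#{i | u i = g} * #{i | u i = h} : ℝ) ≤ n + 2 * #{e | phaseCoeff u e ≠ 1} := by
    exact_mod_cast card_mul_card_le_of_pairing_ne_one u hgh
  have : 0 ≤ α * κ := by positivity
  nlinarith

/-- If `D i₀ ∉ L`, pick `l ∈ L` with `b (D i₀) l ≠ 1`. Evaluating the characters at `l`, the `j`-th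
condition, `j ≠ i₀`, constrains the entry `(i₀, j)` in terms of entries outside the row and column of
`i₀`. -/
lemma sum_columnChar_eq_zero_le (hp : ∀ e, IsBalancedWeight α (p e)) (hα : α ≤ 1)
    (hG : Nat.card G = N) {L : AddSubgroup (G × AddChar G ℂ)}
    (hL : IsIsotropic (dualPairing G) L) (hc : Nat.card L = N) {D : Fin n → G × AddChar G ℂ}
    {i₀ : Fin n} (hD : D i₀ ∉ L) :
    ∑ x : UpperPair n → ZMod N with ∀ j, columnChar (liftSymm x) hL D j = 0, ∏ e, p e (x e) ≤
      (1 - α) ^ (n - 1) := by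
  obtain ⟨l, hl, hne⟩ : ∃ l ∈ L, dualPairing G (D i₀) l ≠ 1 := by
    by_contra! h
    exact hD (hL.mem_of_orthogonal dualPairing_injective (by rw [card_prod_addChar, hG]) hc h)
  set ζ := dualPairing G (D i₀) l with hζ
  let R : {j // j ≠ i₀} → (UpperPair n → ZMod N) → ℂ := fun j x =>
    (∏ i ∈ univ.erase i₀, dualPairing G (D i) l ^ liftSymm x i j) *
      dualQuad l ^ liftSymm x j j
  have hinj : Function.Injective (fun j : {j // j ≠ i₀} => UpperPair.mk' i₀ j.1) := by
    intro j k hjk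
    rcases UpperPair.mk'_eq_iff.1 hjk with h | h
    · exact Subtype.ext h.2
    · exact absurd h.2 j.2
  have h := sum_section_le (p := p) (fun e => (hp e).nonneg) (fun e => (hp e).sum_eq_one)
    (ρ := 1 - α) hinj (fun j x => {s | ζ ^ s.val * R j x = 1}) ?_ ?_
  · refine le_trans (sum_le_sum_of_subset_of_nonneg (fun x hx => ?_) fun x _ _ =>
      prod_nonneg fun e _ => (hp e).nonneg _) (h.trans (le_of_eq ?_))
    · simp only [mem_filter, mem_univ, true_and, Set.mem_ofPred_eq] at hx ⊢
      intro j
      have h1 := DFunLike.congr_fun (hx j) ⟨l, hl⟩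
      rw [columnChar, AddChar.add_apply, restrictChar_apply, AddChar.zsmul_apply,
        AddChar.zero_apply, dualPairing_comm, AddChar.map_sum_eq_prod,
        ← mul_prod_erase _ _ (mem_univ i₀)] at h1
      simp_rw [AddChar.map_zsmul_eq_zpow, dualPairing_comm l] at h1
      rw [mul_assoc] at h1
      rw [← h1, ← zpow_natCast]
      rfl
    · congr 1
      simp [Fintype.card_subtype_compl]
  · intro j x y hxy
    have h1 : ∀ i, i ≠ i₀ → liftSymm x i j = liftSymm y i j := by
      intro i hi
      rw [liftSymm, liftSymm, hxy]
      rintro ⟨k, hk⟩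
      rcases UpperPair.mk'_eq_iff.1 hk with h | h
      · exact hi h.1.symm
      · exact j.2 h.1.symm
    have h2 : R j x = R j y := by
      simp only [R]
      rw [h1 j j.2]
      congr 1
      exact prod_congr rfl fun i hi => by rw [h1 i (ne_of_mem_erase hi)]
    rw [h2]
  · intro j x
    exact (hp _).sum_pow_mul_eq_one_le hα (dualPairing_pow_card hG _ _) hne _

omit [Fintype G] in
lemma sum_columnChar_eq_zero_le_of_mem (hp : ∀ e, IsBalancedWeight α (p e)) (hα : α ≤ 1)
    (hG : Nat.card G = N) {L : AddSubgroup (G × AddChar G ℂ)}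
    (hL : IsIsotropic (dualPairing G) L) {D : Fin n → G × AddChar G ℂ}
    (hD : ∀ i, D i ∈ L) {l : G × AddChar G ℂ} (hl : l ∈ L) (hQ : dualQuad l ≠ 1) :
    ∑ x : UpperPair n → ZMod N with ∀ j, columnChar (liftSymm x) hL D j = 0, ∏ e, p e (x e) ≤
      (1 - α) ^ n := by
  have hinj : Function.Injective (fun j : Fin n => UpperPair.mk' j j) := by
    intro j k hjk
    rcases UpperPair.mk'_eq_iff.1 hjk with h | h <;> exact h.1
  have h := sum_section_le (p := p) (fun e => (hp e).nonneg) (fun e => (hp e).sum_eq_one)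
    (ρ := 1 - α) hinj (fun j x => {s | dualQuad l ^ s.val * 1 = 1}) (fun _ _ _ _ => rfl)
    (fun j x => (hp _).sum_pow_mul_eq_one_le hα (dualQuad_pow_card hG _) hQ _)
  rw [Fintype.card_fin] at h
  refine le_trans (sum_le_sum_of_subset_of_nonneg (fun x hx => ?_) fun x _ _ =>
      prod_nonneg fun e _ => (hp e).nonneg _) h
  simp only [mem_filter, mem_univ, true_and, Set.mem_ofPred_eq] at hx ⊢
  intro j
  have h1 := DFunLike.congr_fun (hx j) ⟨l, hl⟩
  rw [columnChar_of_mem _ hL hD] at h1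
  simpa [liftSymm, isotropicChar_apply, -ZMod.natCast_val] using h1

lemma sum_expectedPhase_coset (p : UpperPair n → ZMod N → ℝ) {L : AddSubgroup (G × AddChar G ℂ)}
    (hL : IsIsotropic (dualPairing G) L) (D : Fin n → G × AddChar G ℂ) :
    ∑ v : Fin n → L, expectedPhase p (fun i => (v i : G × AddChar G ℂ) + D i) =
      (Nat.card L : ℂ) ^ n * ∑ x : UpperPair n → ZMod N with
        ∀ j, columnChar (liftSymm x) hL D j = 0,
          ((∏ e, p e (x e) : ℝ) : ℂ) * matrixPhase (liftSymm x) D := by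
  simp_rw [expectedPhase]
  rw [sum_comm, mul_sum, sum_filter]
  refine sum_congr rfl fun x _ => ?_
  rw [← mul_sum, sum_matrixPhase_coset (liftSymm_isSymm x) hL]
  split_ifs <;> ring

lemma norm_sum_expectedPhase_coset_le (hp : ∀ e, IsBalancedWeight α (p e))
    {L : AddSubgroup (G × AddChar G ℂ)}
    (hL : IsIsotropic (dualPairing G) L) (D : Fin n → G × AddChar G ℂ) :
    ‖∑ v : Fin n → L, expectedPhase p (fun i => (v i : G × AddChar G ℂ) + D i)‖ ≤
      (Nat.card L : ℝ) ^ n * ∑ x : UpperPair n → ZMod N with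
        ∀ j, columnChar (liftSymm x) hL D j = 0, ∏ e, p e (x e) := by
  rw [sum_expectedPhase_coset p hL D, norm_mul, norm_pow, Complex.norm_natCast]
  gcongr
  refine (norm_sum_le _ _).trans (le_of_eq (sum_congr rfl fun x _ => ?_))
  rw [norm_mul, norm_matrixPhase, mul_one, Complex.norm_real, Real.norm_of_nonneg]
  exact prod_nonneg fun e _ => (hp e).nonneg _

/-- The sum over a coset of `L ^ n`, divided by `|L| ^ n`, is at most the probability that all
column characters vanish. They vanish identically for the trivial coset if the quadratic form is
trivial on `L`. The factor `exp α` makes up for the column that may give no condition. -/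
lemma norm_sum_expectedPhase_coset_sub_le (hp : ∀ e, IsBalancedWeight α (p e)) (hα0 : 0 ≤ α)
    (hα : α ≤ 1) (hG : Nat.card G = N) {L : AddSubgroup (G × AddChar G ℂ)}
    (hL : IsIsotropic (dualPairing G) L) (hc : Nat.card L = N) (D : Fin n → G × AddChar G ℂ) :
    ‖∑ v : Fin n → L, expectedPhase p (fun i => (v i : G × AddChar G ℂ) + D i) -
      if (∀ i, D i ∈ L) ∧ (∀ l ∈ L, dualQuad l = 1) then (N : ℂ) ^ n else 0‖ ≤
      N ^ n * (Real.exp α * Real.exp (-α * n)) := by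
  have hexp : (1 - α) ^ (n - 1) ≤ Real.exp α * Real.exp (-α * n) := by
    calc (1 - α) ^ (n - 1) ≤ Real.exp (-α) ^ (n - 1) :=
          pow_le_pow_left₀ (by linarith) (Real.one_sub_le_exp_neg α) _
      _ ≤ _ := by
        rw [← Real.exp_nat_mul, ← Real.exp_add, Real.exp_le_exp]
        have : (n : ℝ) ≤ (n - 1 : ℕ) + 1 := by
          have : n ≤ (n - 1) + 1 := by omega
          exact_mod_cast this
        nlinarith
  have hbound := norm_sum_expectedPhase_coset_le hp hL D
  rw [hc] at hbound
  by_cases hD : ∀ i, D i ∈ L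
  · by_cases hQ : ∀ l ∈ L, dualQuad l = 1
    · have hq : isotropicChar hL = 0 := by
        ext l
        exact hQ l l.2
      have h1 : ∀ M : Matrix (Fin n) (Fin n) ℤ, ∀ j, columnChar M hL D j = 0 := fun M j => by
        rw [columnChar_of_mem M hL hD, hq]
        exact zsmul_zero (α := AddChar L ℂ) (M j j)
      have h2 : ∀ x : UpperPair n → ZMod N, matrixPhase (liftSymm x) D = 1 := fun x => by
        have := matrixPhase_of_isotropic (liftSymm_isSymm x) hL (fun i => ⟨D i, hD i⟩)
        simpa [hq] using this
      rw [if_pos ⟨hD, hQ⟩, sum_expectedPhase_coset p hL D, filter_true_of_mem fun x _ => h1 _, hc]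
      simp_rw [h2, mul_one]
      rw [← Complex.ofReal_sum, sum_prod_weight hp]
      simp only [Complex.ofReal_one, mul_one, sub_self, norm_zero]
      positivity
    · rw [if_neg (fun h => hQ h.2), sub_zero]
      push Not at hQ
      obtain ⟨l, hl, hne⟩ := hQ
      refine hbound.trans ?_
      gcongr
      refine (sum_columnChar_eq_zero_le_of_mem hp hα hG hL hD hl hne).trans (le_trans ?_ hexp)
      exact pow_le_pow_of_le_one (by linarith) (by linarith) (by omega)
  · rw [if_neg (fun h => hD h.1), sub_zero]
    push Not at hD
    obtain ⟨i₀, hi₀⟩ := hD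
    refine hbound.trans ?_
    gcongr
    exact (sum_columnChar_eq_zero_le hp hα hG hL hc hi₀).trans hexp

/-- The expected number of homomorphisms from the cokernel to `G`, for entries distributed according
to balanced weights, is close to the number of isotropic subgroups of order `|G|` on which the
quadratic form is trivial. -/
theorem exists_weighted_hom_estimate (G : Type*) [AddCommGroup G] [Fintype G]
    (hG : Nat.card G = N) (hα0 : 0 < α) (hα : α ≤ 1) {c : ℝ} (hc : c < min α (Real.log 2)) :
    ∃ K : ℝ, ∀ (n : ℕ) (p : UpperPair n → ZMod N → ℝ), (∀ e, IsBalancedWeight α (p e)) →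
      |∑ x : UpperPair n → ZMod N, (∏ e, p e (x e)) *
          Nat.card {g : Fin n → G // ∀ j, ∑ i, liftSymm x i j • g i = 0} -
        Nat.card {L : AddSubgroup (G × AddChar G ℂ) //
          (IsIsotropic (dualPairing G) L ∧ Nat.card L = N) ∧ ∀ l ∈ L, dualQuad l = 1}| ≤
        K * Real.exp (-c * n) := by
  obtain ⟨κ, hκ0, hκ⟩ := exists_le_one_sub_re N
  obtain ⟨K, hK⟩ := exists_lagrangian_estimate (P := G × AddChar G ℂ) (b := dualPairing G) (q := N)
    dualPairing_injective (by rw [card_prod_addChar, hG]) (r := α * κ / 4) (C := Real.exp α)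
    (a := α) (c := c) (by positivity) hc
  refine ⟨K, fun n p hp => ?_⟩
  have h := hK n (expectedPhase p) (fun L => ∀ l ∈ L, dualQuad l = 1)
    (norm_expectedPhase_le_one hp)
    (fun u g h hgh => by
      convert norm_expectedPhase_le_exp hp hα0.le hα hG hκ0.le hκ u g h hgh)
    (fun L hL hcard D => by
      convert norm_sum_expectedPhase_coset_sub_le hp hα0.le hα hG hL hcard D)
  have hsum : ∑ u : Fin n → G × AddChar G ℂ, expectedPhase p u = (N : ℂ) ^ n *
      ((∑ x : UpperPair n → ZMod N, (∏ e, p e (x e)) *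
          #{g : Fin n → G | ∀ j, ∑ i, liftSymm x i j • g i = 0} : ℝ) : ℂ) := by
    simp_rw [expectedPhase]
    rw [sum_comm, Complex.ofReal_sum, mul_sum]
    refine sum_congr rfl fun x _ => ?_
    rw [← mul_sum, sum_matrixPhase, hG]
    push_cast
    ring
  have hN : (0 : ℝ) < (N : ℝ) ^ n := by
    have := NeZero.pos N
    positivity
  rw [hsum, mul_comm _ ((N : ℂ) ^ n), ← mul_sub, norm_mul, norm_pow, Complex.norm_natCast] at h
  have h1 := le_of_mul_le_mul_left h hN
  rw [← Complex.ofReal_natCast, ← Complex.ofReal_sub, Complex.norm_real, Real.norm_eq_abs] at h1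
  refine le_of_eq_of_le ?_ h1
  simp_rw [Nat.card_eq_fintype_card, Fintype.card_subtype]

end WeightedMoment

/-! ### Alternating pairings and the exterior square -/

section ExteriorSquare

/-- Alternating bilinear pairings on `H` with values in the unit circle, curried through characters
of `H`. -/
abbrev AlternatingPairing (H : Type*) [AddCommGroup H] : Type _ :=
  {β : H →+ AddChar H ℂ // ∀ h, β h h = 1}

/-- The exterior square is finitely generated and killed by `|H|`. -/
lemma finite_exteriorSquare (H : Type*) [AddCommGroup H] [Finite H] : Finite (⋀[ℤ]^2 H) := by
  refine Module.finite_of_fg_torsion _ ?_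
  have h : (Nat.card H : ℤ) • (LinearMap.id : ⋀[ℤ]^2 H →ₗ[ℤ] ⋀[ℤ]^2 H) = 0 := by
    refine exteriorPower.linearMap_ext ?_
    ext1 v
    have h1 := (exteriorPower.ιMulti ℤ 2 (M := H)).map_update_smul v 0 (Nat.card H : ℤ) (v 0)
    rw [Function.update_eq_self] at h1
    have h2 : (Nat.card H : ℤ) • v 0 = 0 := by
      rw [natCast_zsmul, card_nsmul_eq_zero']
    rw [h2, AlternatingMap.map_update_zero] at h1
    simpa using h1.symm
  intro x
  refine ⟨⟨(Nat.card H : ℤ), mem_nonZeroDivisors_of_ne_zero ?_⟩, ?_⟩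
  · exact_mod_cast Nat.card_pos.ne'
  · exact LinearMap.congr_fun h x

variable {H : Type*} [AddCommGroup H]

/-- An alternating pairing as an alternating map to the circle, viewed as a `ℤ`-module. -/
noncomputable def AlternatingPairing.toAlternatingMap [Finite H] (β : AlternatingPairing H) :
    H [⋀^Fin 2]→ₗ[ℤ] Additive Circle where
  toFun v := Additive.ofMul (AddChar.circleEquivComplex.symm (β.1 (v 0)) (v 1))
  map_update_add' v i x y := by
    fin_cases i <;> simp [AddChar.map_add_eq_mul]
  map_update_smul' v i c x := by
    fin_cases i <;> simp [AddChar.map_zsmul_eq_zpow]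
  map_eq_zero_of_eq' v i j hij hne := by
    have h01 : v 0 = v 1 := by fin_cases i <;> fin_cases j <;> simp_all
    have h1 : AddChar.circleEquivComplex.symm (β.1 (v 0)) (v 1) = 1 := by
      rw [h01]
      apply Circle.ext
      exact β.2 (v 1)
    rw [h1, ofMul_one]

lemma ιMulti_pair_add_left (h k l : H) : exteriorPower.ιMulti ℤ 2 ![h + k, l] =
    exteriorPower.ιMulti ℤ 2 ![h, l] + exteriorPower.ιMulti ℤ 2 ![k, l] := by
  have hupd : ∀ x : H, Function.update ![0, l] 0 x = ![x, l] := fun x => by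
    ext i; fin_cases i <;> rfl
  simpa only [hupd] using (exteriorPower.ιMulti ℤ 2).map_update_add ![0, l] 0 h k

lemma ιMulti_pair_add_right (h k l : H) : exteriorPower.ιMulti ℤ 2 ![h, k + l] =
    exteriorPower.ιMulti ℤ 2 ![h, k] + exteriorPower.ιMulti ℤ 2 ![h, l] := by
  have hupd : ∀ x : H, Function.update ![h, 0] 1 x = ![h, x] := fun x => by
    ext i; fin_cases i <;> rfl
  simpa only [hupd] using (exteriorPower.ιMulti ℤ 2).map_update_add ![h, 0] 1 k l

/-- The alternating pairing `(h, k) ↦ ψ (h ∧ k)` of a character `ψ` of the exterior square. -/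
def exteriorCharPairing (ψ : AddChar (⋀[ℤ]^2 H) ℂ) : AlternatingPairing H :=
  ⟨{ toFun := fun h =>
      { toFun := fun k => ψ (exteriorPower.ιMulti ℤ 2 ![h, k])
        map_zero_eq_one' := by
          rw [(exteriorPower.ιMulti ℤ 2).map_coord_zero (m := ![h, 0]) 1 (by simp),
            AddChar.map_zero_eq_one]
        map_add_eq_mul' := fun k l => by
          rw [ιMulti_pair_add_right, AddChar.map_add_eq_mul] }
     map_zero' := by
       ext k
       rw [AddChar.coe_mk, (exteriorPower.ιMulti ℤ 2).map_coord_zero (m := ![0, k]) 0 (by simp),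
         AddChar.map_zero_eq_one, AddChar.zero_apply]
     map_add' := fun h k => by
       ext l
       exact (congrArg ψ (ιMulti_pair_add_left h k l)).trans (ψ.map_add_eq_mul _ _) }, fun h => by
    have h1 := (exteriorPower.ιMulti ℤ 2 (M := H)).map_eq_zero_of_eq ![h, h] (i := 0) (j := 1)
      rfl zero_ne_one
    exact (congrArg ψ h1).trans ψ.map_zero_eq_one⟩

lemma exteriorCharPairing_apply (ψ : AddChar (⋀[ℤ]^2 H) ℂ) (h k : H) :
    (exteriorCharPairing ψ).1 h k = ψ (exteriorPower.ιMulti ℤ 2 ![h, k]) := rfl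

lemma exteriorCharPairing_injective :
    Function.Injective (exteriorCharPairing : AddChar (⋀[ℤ]^2 H) ℂ → AlternatingPairing H) := by
  intro ψ φ h
  ext x
  have hx : x ∈ Submodule.span ℤ (Set.range (exteriorPower.ιMulti ℤ 2 (M := H))) := by
    rw [exteriorPower.ιMulti_span]; trivial
  induction hx using Submodule.span_induction with
  | mem x hx =>
    obtain ⟨v, rfl⟩ := hx
    have h1 := DFunLike.congr_fun (DFunLike.congr_fun (congrArg Subtype.val h) (v 0)) (v 1)
    rw [exteriorCharPairing_apply, exteriorCharPairing_apply] at h1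
    have h2 : ![v 0, v 1] = v := by ext i; fin_cases i <;> rfl
    rwa [h2] at h1
  | zero => simp
  | add x y _ _ hx hy => rw [AddChar.map_add_eq_mul, AddChar.map_add_eq_mul, hx, hy]
  | smul a x _ hx => rw [AddChar.map_zsmul_eq_zpow, AddChar.map_zsmul_eq_zpow, hx]

lemma exteriorCharPairing_surjective [Finite H] :
    Function.Surjective (exteriorCharPairing : AddChar (⋀[ℤ]^2 H) ℂ → AlternatingPairing H) := by
  intro β
  let F := exteriorPower.alternatingMapLinearEquiv β.toAlternatingMap
  refine ⟨Circle.coeHom.compAddChar (AddChar.toAddMonoidHomEquiv.symm F.toAddMonoidHom), ?_⟩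
  ext h k
  rw [exteriorCharPairing_apply]
  have h1 : F (exteriorPower.ιMulti ℤ 2 ![h, k]) = β.toAlternatingMap ![h, k] :=
    exteriorPower.alternatingMapLinearEquiv_apply_ιMulti _ _
  exact congrArg (fun z : Additive Circle => ((Additive.toMul z : Circle) : ℂ)) h1

lemma card_alternatingPairing [Finite H] :
    Nat.card (AlternatingPairing H) = Nat.card (⋀[ℤ]^2 H) := by
  have := finite_exteriorSquare H
  have := Fintype.ofFinite (⋀[ℤ]^2 H)
  rw [← Nat.card_congr (Equiv.ofBijective _
    ⟨exteriorCharPairing_injective (H := H), exteriorCharPairing_surjective⟩),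
    Nat.card_eq_fintype_card, AddChar.card_eq, Nat.card_eq_fintype_card]

end ExteriorSquare

/-! ### Counting singular Lagrangians -/

section LagrangianCount

variable {G : Type*} [AddCommGroup G]

/-- The subgroup of pairs `(h, χ)` with `h ∈ H` and `χ` restricting to `β h` on `H`. -/
def pairingGraph (H : AddSubgroup G) (β : H →+ AddChar H ℂ) : AddSubgroup (G × AddChar G ℂ) where
  carrier := {u | ∃ h : H, (h : G) = u.1 ∧ restrictChar H u.2 = β h}
  zero_mem' := ⟨0, rfl, by simp⟩
  add_mem' := by
    rintro u v ⟨h, hu, hu'⟩ ⟨k, hv, hv'⟩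
    exact ⟨h + k, by simp [hu, hv], by rw [Prod.snd_add, map_add, map_add, hu', hv']⟩
  neg_mem' := by
    rintro u ⟨h, hu, hu'⟩
    exact ⟨-h, by simp [hu], by rw [Prod.snd_neg, map_neg, map_neg, hu']⟩

lemma mem_pairingGraph {H : AddSubgroup G} {β : H →+ AddChar H ℂ} {u : G × AddChar G ℂ} :
    u ∈ pairingGraph H β ↔ ∃ h : H, (h : G) = u.1 ∧ restrictChar H u.2 = β h := Iff.rfl

lemma dualQuad_of_mem_pairingGraph {H : AddSubgroup G} (β : AlternatingPairing H)
    {u : G × AddChar G ℂ} (hu : u ∈ pairingGraph H β.1) : dualQuad u = 1 := by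
  obtain ⟨h, h1, h2⟩ := hu
  rw [dualQuad, ← h1, ← restrictChar_apply, h2, β.2]

lemma isIsotropic_of_dualQuad {L : AddSubgroup (G × AddChar G ℂ)} (hL : ∀ u ∈ L, dualQuad u = 1) :
    IsIsotropic (dualPairing G) L := by
  intro u hu v hv
  have h := dualQuad_add u v
  rw [hL _ hu, hL _ hv, hL _ (add_mem hu hv)] at h
  simpa using h.symm

/-- The graph is the kernel of the surjection `(h, χ) ↦ χ|_H - β h` from `H × Ĝ` to the dual of
`H`. -/
lemma card_pairingGraph [Finite G] (H : AddSubgroup G) (β : H →+ AddChar H ℂ) :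
    Nat.card (pairingGraph H β) = Nat.card G := by
  have := Fintype.ofFinite G
  have := Fintype.ofFinite H
  let φ : H × AddChar G ℂ →+ AddChar H ℂ :=
    (restrictChar H).comp (AddMonoidHom.snd _ _) - β.comp (AddMonoidHom.fst _ _)
  have hφ : ∀ h χ, φ (h, χ) = restrictChar H χ - β h := fun _ _ => rfl
  have hs : Function.Surjective φ := fun ψ => by
    obtain ⟨χ, hχ⟩ := restrictChar_surjective H ψ
    exact ⟨(0, χ), by rw [hφ, map_zero, sub_zero, hχ]⟩
  have h1 := AddSubgroup.card_eq_card_quotient_mul_card_addSubgroup φ.ker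
  rw [Nat.card_congr (QuotientAddGroup.quotientKerEquivOfSurjective _ hs).toEquiv, Nat.card_prod,
    Nat.card_eq_fintype_card (α := AddChar H ℂ), AddChar.card_eq,
    Nat.card_eq_fintype_card (α := AddChar G ℂ), AddChar.card_eq, ← Nat.card_eq_fintype_card,
    ← Nat.card_eq_fintype_card] at h1
  rw [Nat.eq_of_mul_eq_mul_left Nat.card_pos h1]
  refine Nat.card_congr
    { toFun := fun u => ⟨(⟨u.1.1, by obtain ⟨h, h1, _⟩ := u.2; exact h1 ▸ h.2⟩, u.1.2), ?_⟩
      invFun := fun w => ⟨(w.1.1, w.1.2), w.1.1, rfl, ?_⟩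
      left_inv := fun u => rfl
      right_inv := fun w => rfl }
  · obtain ⟨h, h1, h2⟩ := u.2
    have h3 : (⟨u.1.1, h1 ▸ h.2⟩ : H) = h := Subtype.ext h1.symm
    rw [AddMonoidHom.mem_ker, hφ, h3, h2, sub_self]
  · exact sub_eq_zero.1 w.2

/-- The singular Lagrangian attached to a subgroup `H` of `G` and an alternating pairing on `H`. -/
def graphLagrangian [Finite G] (x : Σ H : AddSubgroup G, AlternatingPairing H) :
    {L : AddSubgroup (G × AddChar G ℂ) //
      (IsIsotropic (dualPairing G) L ∧ Nat.card L = Nat.card G) ∧ ∀ l ∈ L, dualQuad l = 1} :=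
  ⟨pairingGraph x.1 x.2.1,
    ⟨isIsotropic_of_dualQuad fun _ => dualQuad_of_mem_pairingGraph x.2, card_pairingGraph _ _⟩,
    fun _ => dualQuad_of_mem_pairingGraph x.2⟩

lemma exists_mem_pairingGraph [Finite G] {H : AddSubgroup G} (β : H →+ AddChar H ℂ) (h : H) :
    ∃ χ : AddChar G ℂ, restrictChar H χ = β h ∧ ((h : G), χ) ∈ pairingGraph H β := by
  obtain ⟨χ, hχ⟩ := restrictChar_surjective H (β h)
  exact ⟨χ, hχ, h, rfl, hχ⟩

lemma graphLagrangian_injective [Finite G] :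
    Function.Injective (graphLagrangian (G := G)) := by
  rintro ⟨H, β⟩ ⟨H', β'⟩ h
  have h1 : pairingGraph H β.1 = pairingGraph H' β'.1 := congrArg Subtype.val h
  have hle : ∀ {H H' : AddSubgroup G} {β : H →+ AddChar H ℂ} {β' : H' →+ AddChar H' ℂ},
      pairingGraph H β = pairingGraph H' β' → H ≤ H' := by
    intro H H' β β' h1 g hg
    obtain ⟨χ, _, hχ⟩ := exists_mem_pairingGraph β ⟨g, hg⟩
    rw [h1] at hχ
    obtain ⟨k, hk, _⟩ := hχ
    have hk' : (k : G) = g := hk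
    exact hk' ▸ k.2
  obtain rfl : H = H' := le_antisymm (hle h1) (hle h1.symm)
  congr
  ext1
  ext1 k
  obtain ⟨χ, hχ, hmem⟩ := exists_mem_pairingGraph β.1 k
  rw [h1] at hmem
  obtain ⟨k', hk', h2⟩ := hmem
  obtain rfl : k' = k := Subtype.ext hk'
  rw [← hχ, ← h2]

lemma graphLagrangian_surjective [Finite G] :
    Function.Surjective (graphLagrangian (G := G)) := by
  rintro ⟨L, ⟨hiso, hcard⟩, hQ⟩
  let H : AddSubgroup G := L.map (AddMonoidHom.fst G (AddChar G ℂ))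
  have hlift : ∀ h : H, ∃ u ∈ L, u.1 = (h : G) := fun h => by
    obtain ⟨u, hu, hu'⟩ := h.2
    exact ⟨u, hu, hu'⟩
  -- two elements of `L` over the same point of `H` agree on `H`, by isotropy
  have hwd : ∀ u ∈ L, ∀ v ∈ L, u.1 = v.1 → restrictChar H u.2 = restrictChar H v.2 := by
    intro u hu v hv huv
    ext k
    obtain ⟨w, hw, hk⟩ := hlift k
    have h1 := (hiso u hu w hw).trans (hiso v hv w hw).symm
    rw [dualPairing_apply, dualPairing_apply, huv] at h1
    have h2 := mul_right_cancel₀ (w.2.val_isUnit v.1).ne_zero h1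
    rw [restrictChar_apply, restrictChar_apply, ← hk, h2]
  choose f hf hf' using hlift
  let β : H →+ AddChar H ℂ :=
    { toFun := fun h => restrictChar H (f h).2
      map_zero' := by
        rw [hwd _ (hf 0) 0 (zero_mem _) (hf' 0)]
        simp
      map_add' := fun h k => by
        rw [← map_add, ← Prod.snd_add]
        exact hwd _ (hf _) _ (add_mem (hf h) (hf k)) (by simp [hf']) }
  have hβ : ∀ h, β h h = 1 := fun h => by
    have := hQ _ (hf h)
    rwa [dualQuad, hf' h] at this
  refine ⟨⟨H, β, hβ⟩, Subtype.ext ?_⟩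
  symm
  refine AddSubgroup.eq_of_le_of_card_ge (fun u hu => ?_) ?_
  · have hmem : u.1 ∈ H := ⟨u, hu, rfl⟩
    exact ⟨⟨u.1, hmem⟩, rfl, hwd u hu _ (hf _) (hf' ⟨u.1, hmem⟩).symm⟩
  · rw [hcard]
    exact (card_pairingGraph H β).le

/-- The singular Lagrangians of `G × Ĝ` correspond to the subgroups of `G` with an alternating
pairing. -/
theorem card_singular_lagrangian [Fintype (AddSubgroup G)] [Finite G] :
    Nat.card {L : AddSubgroup (G × AddChar G ℂ) //
      (IsIsotropic (dualPairing G) L ∧ Nat.card L = Nat.card G) ∧ ∀ l ∈ L, dualQuad l = 1} =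
    ∑ H : AddSubgroup G, Nat.card (⋀[ℤ]^2 H) := by
  have hfin : ∀ H : AddSubgroup G, Finite (AlternatingPairing H) := fun H =>
    Finite.of_injective (fun β : AlternatingPairing H => (β.1 : H → AddChar H ℂ))
      fun β γ h => Subtype.ext (DFunLike.coe_injective h)
  rw [← Nat.card_congr (Equiv.ofBijective _
    ⟨graphLagrangian_injective (G := G), graphLagrangian_surjective⟩), Nat.card_sigma]
  exact Finset.sum_congr rfl fun H _ => card_alternatingPairing

end LagrangianCount

/-! ### Homomorphisms from a cokernel -/

section Cokernel
open Finset

variable {G : Type*} [AddCommGroup G] {n : ℕ}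

/-- A homomorphism from the cokernel as a tuple of images of the basis vectors, which kills the
columns of `M`. -/
def cokHomEval (M : Matrix (Fin n) (Fin n) ℤ) (φ : M.Cok →+ G) :
    {g : Fin n → G // ∀ j, ∑ i, M i j • g i = 0} :=
  ⟨fun i => φ (Submodule.Quotient.mk (Pi.single i 1)), fun j => by
    have h1 : (∑ i, M i j • Pi.single i (1 : ℤ) : Fin n → ℤ) = M.mulVecLin (Pi.single j 1) := by
      ext k
      simp [Finset.sum_apply, Pi.single_apply]
    have h2 : (Submodule.Quotient.mk (∑ i, M i j • Pi.single i (1 : ℤ)) : M.Cok) = 0 := by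
      rw [Submodule.Quotient.mk_eq_zero, h1]
      exact LinearMap.mem_range_self _ _
    rw [← φ.map_zero, ← h2, ← Submodule.mkQ_apply, map_sum, map_sum]
    refine sum_congr rfl fun i _ => ?_
    rw [map_smul, map_zsmul, Submodule.mkQ_apply]⟩

lemma cokHomEval_bijective (M : Matrix (Fin n) (Fin n) ℤ) :
    Function.Bijective (cokHomEval M : (M.Cok →+ G) → _) := by
  constructor
  · intro φ ψ h
    have h1 : φ.toIntLinearMap.comp (Submodule.mkQ _) =
        ψ.toIntLinearMap.comp (Submodule.mkQ _) := by
      refine LinearMap.pi_ext' fun i => LinearMap.ext_ring ?_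
      exact congrFun (congrArg Subtype.val h) i
    ext x
    obtain ⟨y, rfl⟩ := Submodule.Quotient.mk_surjective _ x
    exact LinearMap.congr_fun h1 y
  · rintro ⟨g, hg⟩
    have hle : LinearMap.range M.mulVecLin ≤ LinearMap.ker (Fintype.linearCombination ℤ g) := by
      rintro _ ⟨y, rfl⟩
      rw [LinearMap.mem_ker, Fintype.linearCombination_apply]
      have h1 : ∀ i, (M.mulVecLin y) i • g i = ∑ j, y j • M i j • g i := fun i => by
        rw [Matrix.mulVecLin_apply, Matrix.mulVec, dotProduct, sum_smul]
        refine sum_congr rfl fun j _ => ?_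
        rw [mul_comm, mul_smul]
      simp_rw [h1]
      rw [sum_comm]
      simp_rw [← smul_sum, hg, smul_zero]
      simp
    refine ⟨((LinearMap.range M.mulVecLin).liftQ _ hle).toAddMonoidHom, Subtype.ext ?_⟩
    ext i
    change (Fintype.linearCombination ℤ g) (Pi.single i 1) = g i
    simp

lemma card_cok_hom (M : Matrix (Fin n) (Fin n) ℤ) :
    Nat.card (M.Cok →+ G) = Nat.card {g : Fin n → G // ∀ j, ∑ i, M i j • g i = 0} :=
  Nat.card_congr (Equiv.ofBijective _ (cokHomEval_bijective M))

lemma finite_cok_hom [Finite G] (M : Matrix (Fin n) (Fin n) ℤ) : Finite (M.Cok →+ G) :=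
  Finite.of_injective _ (cokHomEval_bijective M).injective

/-- Sort homomorphisms by their image. -/
lemma card_hom_eq_sum_card_sur {A : Type*} [AddCommGroup A] [Fintype (AddSubgroup G)]
    [∀ H : AddSubgroup G, Finite (A →+ H)] :
    Nat.card (A →+ G) = ∑ H : AddSubgroup G, Nat.card (Sur A H) := by
  have hbij : Function.Bijective
      (fun x : Σ H : AddSubgroup G, Sur A H => x.1.subtype.comp x.2.1) := by
    constructor
    · rintro ⟨H, f⟩ ⟨H', f'⟩ h
      have hle : ∀ {H H' : AddSubgroup G} (f : Sur A H) (f' : Sur A H'),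
          H.subtype.comp f.1 = H'.subtype.comp f'.1 → H ≤ H' := by
        intro H H' f f' h g hg
        obtain ⟨a, ha⟩ := f.2 ⟨g, hg⟩
        have h1 : ((f.1 a : H) : G) = (f'.1 a : H') := DFunLike.congr_fun h a
        rw [ha] at h1
        have h2 : g = (f'.1 a : H') := h1
        exact h2 ▸ (f'.1 a).2
      obtain rfl : H = H' := le_antisymm (hle f f' h) (hle f' f h.symm)
      congr
      ext1
      ext a
      exact DFunLike.congr_fun h a
    · intro f
      exact ⟨⟨f.range, f.rangeRestrict, f.rangeRestrict_surjective⟩, rfl⟩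
  have : ∀ H : AddSubgroup G, Finite (Sur A H) := fun H => Subtype.finite
  rw [← Nat.card_congr (Equiv.ofBijective _ hbij), Nat.card_sigma]

end Cokernel

/-! ### The law of the residues -/

section Measure
open Finset

variable {Ω : Type*} [MeasurableSpace Ω] {μ : Measure Ω} [IsProbabilityMeasure μ] {n N : ℕ}
  [NeZero N]

lemma natCast_val_intCast {ℓ : ℕ} (h : ℓ ∣ N) (z : ℤ) :
    ((((z : ZMod N)).val : ℕ) : ZMod ℓ) = (z : ZMod ℓ) := by
  rw [ZMod.natCast_val, ZMod.cast_intCast h]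

lemma intCast_smul_val {G : Type*} [AddCommGroup G] (hG : Nat.card G = N) (z : ℤ) (g : G) :
    (((z : ZMod N).val : ℕ) : ℤ) • g = z • g := by
  have h1 : (N : ℤ) ∣ z - ((z : ZMod N).val : ℕ) := by
    rw [← ZMod.intCast_zmod_eq_zero_iff_dvd]
    simp
  obtain ⟨k, hk⟩ := h1
  have h2 : (z - ((z : ZMod N).val : ℕ)) • g = 0 := by
    rw [hk, mul_comm, mul_smul, natCast_zsmul, ← hG, card_nsmul_eq_zero', smul_zero]
  rw [sub_smul, sub_eq_zero] at h2
  exact h2.symm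

/-- The residues modulo `N` of the entries on and above the diagonal. -/
def residues (N : ℕ) (M : Matrix (Fin n) (Fin n) ℤ) : UpperPair n → ZMod N :=
  fun e => (M e.1.1 e.1.2 : ZMod N)

/-- The distribution of one residue of the random matrix `X`. -/
noncomputable def residueWeight (μ : Measure Ω) (N : ℕ) (X : Ω → Matrix (Fin n) (Fin n) ℤ)
    (e : UpperPair n) (s : ZMod N) : ℝ :=
  μ.real ((fun ω => residues N (X ω) e) ⁻¹' {s})

variable {X : Ω → Matrix (Fin n) (Fin n) ℤ}

omit [IsProbabilityMeasure μ] [NeZero N] in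
lemma measurableSet_residues (hX : IsRandomSymmetric μ X) (e : UpperPair n) (s : Set (ZMod N)) :
    MeasurableSet ((fun ω => residues N (X ω) e) ⁻¹' s) :=
  hX.measurable_entry e.1.1 e.1.2
    (MeasurableSet.of_discrete (s := (fun z : ℤ => (z : ZMod N)) ⁻¹' s))

lemma isBalancedWeight_residueWeight (hX : IsRandomSymmetric μ X) {α : ℝ}
    (hα : ∀ p : ℕ, p.Prime → p ∣ N → ∀ (t : ZMod p) (i j : Fin n), i ≤ j →
      μ.real {ω | ((X ω i j : ℤ) : ZMod p) = t} ≤ 1 - α) (e : UpperPair n) :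
    IsBalancedWeight α (residueWeight μ N X e) where
  nonneg s := measureReal_nonneg
  sum_eq_one := by
    simp_rw [residueWeight]
    rw [sum_measureReal_preimage_singleton _ fun s _ => measurableSet_residues hX e {s}]
    simp
  balanced ℓ hℓ hdvd t := by
    simp_rw [residueWeight]
    rw [sum_measureReal_preimage_singleton _ fun s _ => measurableSet_residues hX e {s}]
    refine le_of_eq_of_le ?_ (hα ℓ hℓ hdvd t e.1.1 e.1.2 e.2)
    congr 1
    ext ω
    simp [residues, natCast_val_intCast hdvd, -ZMod.natCast_val]

omit [IsProbabilityMeasure μ] [NeZero N] in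
lemma measureReal_residues (hX : IsRandomSymmetric μ X) (x : UpperPair n → ZMod N) :
    μ.real ((fun ω => residues N (X ω)) ⁻¹' {x}) = ∏ e, residueWeight μ N X e (x e) := by
  have h := hX.indep.measure_inter_preimage_eq_mul univ
    (sets := fun e => (fun z : ℤ => (z : ZMod N)) ⁻¹' {x e}) fun e _ => MeasurableSet.of_discrete
  have h1 : (fun ω => residues N (X ω)) ⁻¹' {x} = ⋂ e ∈ (univ : Finset (UpperPair n)),
      (fun ω => X ω e.1.1 e.1.2) ⁻¹' ((fun z : ℤ => (z : ZMod N)) ⁻¹' {x e}) := by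
    ext ω
    simp [residues, funext_iff]
  rw [measureReal_def, h1, h, ENNReal.toReal_prod]
  rfl

lemma integral_residues (hX : IsRandomSymmetric μ X) (F : (UpperPair n → ZMod N) → ℝ) :
    Integrable (fun ω => F (residues N (X ω))) μ ∧
      ∫ ω, F (residues N (X ω)) ∂μ = ∑ x, (∏ e, residueWeight μ N X e (x e)) * F x := by
  let m : MeasurableSpace (UpperPair n → ZMod N) := ⊤
  have hm : Measurable fun ω => residues N (X ω) := by
    refine measurable_to_countable' fun x => ?_
    have h1 : (fun ω => residues N (X ω)) ⁻¹' {x} =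
        ⋂ e, (fun ω => residues N (X ω) e) ⁻¹' {x e} := by
      ext ω; simp [funext_iff]
    rw [h1]
    exact MeasurableSet.iInter fun e => measurableSet_residues hX e _
  have hprob := Measure.isProbabilityMeasure_map (μ := μ) hm.aemeasurable
  have hint : Integrable F (μ.map fun ω => residues N (X ω)) := Integrable.of_finite
  refine ⟨hint.comp_measurable hm, ?_⟩
  rw [← integral_map hm.aemeasurable hint.aestronglyMeasurable, integral_fintype hint]
  refine sum_congr rfl fun x _ => ?_
  rw [map_measureReal_apply hm (MeasurableSet.of_discrete), measureReal_residues hX, smul_eq_mul]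

end Measure

/-! ### Moments -/

section Moments
open Finset

universe u v

/-- The expected number of homomorphisms to `G` is close to the sum of `|∧² H|` over the subgroups
`H` of `G`. -/
theorem exists_hom_moment_estimate {G : Type u} [AddCommGroup G] [Finite G]
    [Fintype (AddSubgroup G)] {α : ℝ}
    (hα0 : 0 < α) (hα1 : α ≤ 1) {c : ℝ} (hc : c < min α (Real.log 2)) :
    ∃ K : ℝ, ∀ (n : ℕ) (Ω : Type v) [MeasurableSpace Ω] (μ : Measure Ω) [IsProbabilityMeasure μ]
        (X : Ω → Matrix (Fin n) (Fin n) ℤ),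
        IsRandomSymmetric μ X →
        (∀ p : ℕ, p.Prime → p ∣ Nat.card G → ∀ (t : ZMod p) (i j : Fin n), i ≤ j →
          μ.real {ω | ((X ω i j : ℤ) : ZMod p) = t} ≤ 1 - α) →
        Integrable (fun ω => (Nat.card ((X ω).Cok →+ G) : ℝ)) μ ∧
          |(∫ ω, (Nat.card ((X ω).Cok →+ G) : ℝ) ∂μ) -
            ∑ H : AddSubgroup G, (Nat.card (⋀[ℤ]^2 H) : ℝ)| ≤ K * Real.exp (-c * n) := by
  have := Fintype.ofFinite G
  have : NeZero (Nat.card G) := ⟨Nat.card_pos.ne'⟩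
  obtain ⟨K, hK⟩ := exists_weighted_hom_estimate G (N := Nat.card G) rfl hα0 hα1 hc
  refine ⟨K, fun n Ω _ μ _ X hX hbal => ?_⟩
  have h1 : ∀ ω, (Nat.card ((X ω).Cok →+ G) : ℝ) = Nat.card {g : Fin n → G //
      ∀ j, ∑ i, liftSymm (residues (Nat.card G) (X ω)) i j • g i = 0} := by
    intro ω
    rw [card_cok_hom]
    have h2 : ∀ i j (g : G),
        liftSymm (residues (Nat.card G) (X ω)) i j • g = X ω i j • g := by
      intro i j g
      refine (intCast_smul_val rfl _ g).trans ?_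
      rcases le_total i j with h | h
      · simp [UpperPair.mk', h]
      · simp [UpperPair.mk', h, (hX.symm ω).apply i j]
    simp_rw [h2]
  obtain ⟨hi, he⟩ := integral_residues (N := Nat.card G) hX fun x =>
    (Nat.card {g : Fin n → G // ∀ j, ∑ i, liftSymm x i j • g i = 0} : ℝ)
  simp_rw [h1]
  refine ⟨hi, ?_⟩
  rw [he]
  have h3 := hK n (residueWeight μ (Nat.card G) X) (isBalancedWeight_residueWeight hX hbal)
  rw [card_singular_lagrangian] at h3
  exact_mod_cast h3

lemma card_exteriorSquare_congr {A B : Type*} [AddCommGroup A] [AddCommGroup B] (e : A ≃+ B) :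
    Nat.card (⋀[ℤ]^2 A) = Nat.card (⋀[ℤ]^2 B) := by
  let f : A ≃ₗ[ℤ] B := e.toIntLinearEquiv
  refine Nat.card_congr
    { toFun := exteriorPower.map 2 f.toLinearMap
      invFun := exteriorPower.map 2 f.symm.toLinearMap
      left_inv := fun x => ?_
      right_inv := fun x => ?_ }
  · rw [← LinearMap.comp_apply, ← exteriorPower.map_comp]
    simp
  · rw [← LinearMap.comp_apply, ← exteriorPower.map_comp]
    simp

lemma card_sur_congr {A B C : Type*} [AddCommGroup A] [AddCommGroup B] [AddCommGroup C]
    (e : B ≃+ C) : Nat.card (Sur A B) = Nat.card (Sur A C) :=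
  Nat.card_congr
    { toFun := fun f => ⟨e.toAddMonoidHom.comp f.1, e.surjective.comp f.2⟩
      invFun := fun f => ⟨e.symm.toAddMonoidHom.comp f.1, e.symm.surjective.comp f.2⟩
      left_inv := fun f => by ext; simp
      right_inv := fun f => by ext; simp }

/-- The number of surjections to `G` is the number of homomorphisms to `G` minus the numbers of
surjections to the proper subgroups, so the estimate follows by induction on the order of `G`. -/
theorem exists_sur_moment_estimate {α : ℝ} (hα0 : 0 < α) (hα1 : α ≤ 1) {c : ℝ}
    (hc : c < min α (Real.log 2)) (k : ℕ) :
    ∀ (G : Type u) [AddCommGroup G] [Finite G], Nat.card G = k →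
    ∃ K : ℝ, ∀ (n : ℕ) (Ω : Type v) [MeasurableSpace Ω] (μ : Measure Ω) [IsProbabilityMeasure μ]
        (X : Ω → Matrix (Fin n) (Fin n) ℤ),
        IsRandomSymmetric μ X →
        (∀ p : ℕ, p.Prime → p ∣ Nat.card G → ∀ (t : ZMod p) (i j : Fin n), i ≤ j →
          μ.real {ω | ((X ω i j : ℤ) : ZMod p) = t} ≤ 1 - α) →
        Integrable (fun ω => (Nat.card (Sur (X ω).Cok G) : ℝ)) μ ∧
          |(∫ ω, (Nat.card (Sur (X ω).Cok G) : ℝ) ∂μ) - (Nat.card (⋀[ℤ]^2 G) : ℝ)|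
            ≤ K * Real.exp (-c * n) := by
  classical
  induction k using Nat.strong_induction_on with
  | _ k ih =>
  intro G _ _ hGk
  have := Fintype.ofFinite (AddSubgroup G)
  obtain ⟨K, hK⟩ := exists_hom_moment_estimate.{u, v} (G := G) hα0 hα1 hc
  have hlt : ∀ H ∈ univ.erase (⊤ : AddSubgroup G), Nat.card H < k := by
    intro H hH
    rw [← hGk, ← AddSubgroup.card_top (G := G)]
    refine lt_of_le_of_ne (AddSubgroup.card_le_of_le le_top) fun h => ne_of_mem_erase hH ?_
    exact AddSubgroup.eq_of_le_of_card_ge le_top h.ge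
  choose! K' hK' using fun H hH => ih _ (hlt H hH) H rfl
  refine ⟨K + ∑ H ∈ univ.erase (⊤ : AddSubgroup G), K' H, fun n Ω _ μ _ X hX hbal => ?_⟩
  obtain ⟨hi, he⟩ := hK n Ω μ X hX hbal
  have hsub := fun H hH => hK' H hH n Ω μ X hX fun p hp hdvd =>
    hbal p hp (hdvd.trans (AddSubgroup.card_addSubgroup_dvd_card H))
  have hdecomp : (fun ω => (Nat.card (Sur (X ω).Cok G) : ℝ)) = fun ω =>
      (Nat.card ((X ω).Cok →+ G) : ℝ) -
        ∑ H ∈ univ.erase (⊤ : AddSubgroup G), (Nat.card (Sur (X ω).Cok H) : ℝ) := by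
    funext ω
    have := fun H : AddSubgroup G => finite_cok_hom (G := H) (X ω)
    rw [card_hom_eq_sum_card_sur, ← add_sum_erase _ _ (mem_univ (⊤ : AddSubgroup G)),
      card_sur_congr (B := (⊤ : AddSubgroup G)) AddSubgroup.topEquiv]
    push_cast
    ring
  have hext : (Nat.card (⋀[ℤ]^2 G) : ℝ) = ∑ H : AddSubgroup G, (Nat.card (⋀[ℤ]^2 H) : ℝ) -
      ∑ H ∈ univ.erase (⊤ : AddSubgroup G), (Nat.card (⋀[ℤ]^2 H) : ℝ) := by
    rw [← add_sum_erase _ _ (mem_univ (⊤ : AddSubgroup G)),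
      card_exteriorSquare_congr (A := (⊤ : AddSubgroup G)) AddSubgroup.topEquiv]
    ring
  have hisum := integrable_finsetSum (univ.erase (⊤ : AddSubgroup G)) fun H hH => (hsub H hH).1
  rw [hdecomp]
  refine ⟨hi.sub hisum, ?_⟩
  rw [integral_sub hi hisum, integral_finsetSum _ fun H hH => (hsub H hH).1, hext,
    sub_sub_sub_comm, ← sum_sub_distrib, add_mul, sum_mul]
  refine (abs_sub _ _).trans (add_le_add he ?_)
  exact (abs_sum_le_sum_abs _ _).trans (sum_le_sum fun H hH => (hsub H hH).2)

end Moments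

theorem theoremT {G : Type*} [AddCommGroup G] [Finite G] (α : ℝ) (hα0 : 0 < α) (hα1 : α < 1)
    (c : ℝ) (hc : c < min α (Real.log 2)) :
    ∃ K : ℝ, 0 < K ∧
      ∀ (n : ℕ) (Ω : Type*) [MeasurableSpace Ω] (μ : Measure Ω) [IsProbabilityMeasure μ]
        (X : Ω → Matrix (Fin n) (Fin n) ℤ),
        IsRandomSymmetric μ X →
        (∀ p : ℕ, p.Prime → p ∣ Nat.card G → ∀ (t : ZMod p) (i j : Fin n), i ≤ j →
          μ.real {ω | ((X ω i j : ℤ) : ZMod p) = t} ≤ 1 - α) →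
        Integrable (fun ω => (Nat.card (Sur (X ω).Cok G) : ℝ)) μ ∧
          |(∫ ω, (Nat.card (Sur (X ω).Cok G) : ℝ) ∂μ) - (Nat.card (⋀[ℤ]^2 G) : ℝ)|
            ≤ K * Real.exp (-c * n) := by
  obtain ⟨K, hK⟩ := exists_sur_moment_estimate hα0 hα1.le hc _ G rfl
  refine ⟨max K 1, by positivity, fun n Ω _ μ _ X hX hbal => ?_⟩
  obtain ⟨hi, he⟩ := hK n Ω μ X hX hbal
  refine ⟨hi, he.trans ?_⟩
  gcongr
  exact le_max_left _ _
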